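/- Let $\mathbb T^1=\mathbb R/\mathbb Z$ and $\mathbb T^2=\mathbb R^2/\mathbb Z^2$, let $f:\mathbb T^2\to\mathbb T^2$ be a homeomorphism (not necessarily homotopic to the identity) and let $F:\mathbb R^2\to\mathbb R^2$ be a lift of $f$. Let $\alpha\in\mathbb R\setminus\mathbb Q$ and assume the following. 1. $f$ is nonwandering: for every nonempty open $U\subseteq\mathbb T^2$ there is $n\ge 1$ with $f^n(U)\cap U\neq\emptyset$. 2. $f$ is non-annular, that is, no iterate $f^k$ with $k\geq 1$ is annular; here a homeomorphism $g$ of $\mathbb T^2$ is called annular if there exist $M>0$, a vector $v\in\mathbb Z^2\setminus\{0\}$ and a lift $G$ of $g$ such that $|\langle G^n(z)-z,v\rangle|<M$ for all $n\in\mathbb N$ and $z\in\mathbb R^2$. 3. The rotation set $\rho(F)=\bigcap_{n\in\mathbb N}\overline{\bigcup_{m\ge n}\{(F^m(z)-z)/m : z\in\mathbb R^2\}}$ is contained in $\{\alpha\}\times\mathbb R$. 4. $f$ has bounded deviations in the direction of $v=(1,0)$: there are $a\in\mathbb R$ and $C>0$ such that $\bigcap_{n\in\mathbb N}\overline{\bigcup_{m\geq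 n}\{\langle F^m(z)-z,v\rangle/m : z\in\mathbb R^2\}}=\{a\}$ and $|\langle F^n(z)-z,v\rangle-na|\le C$ for all $n\in\mathbb N$ and $z\in\mathbb R^2$. 5. No iterate $f^k$ with $k\ge 1$ is a pseudo-rotation with uniformly bounded deviations; here a homeomorphism $g$ of $\mathbb T^2$ is called a pseudo-rotation with uniformly bounded deviations if it is homotopic to the identity and there exist a lift $G$ of $g$, a vector $\rho\in\mathbb R^2$ and $C>0$ such that $\|G^n(z)-z-n\rho\|\le C$ for all $n\in\mathbb N$ and $z\in\mathbb R^2$. Then $f$ is semiconjugate to the irrational rotation $R_\alpha:x\mapsto x+\alpha$ on $\mathbb T^1$: there is a continuous surjective map $h:\mathbb T^2\to\mathbb T^1$ with $h\circ f=R_\alpha\circ h$. -/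

import Mathlib

open Set Topology

namespace TorusRotationFactor

/-- The circle `ℝ / ℤ`. -/
abbrev T1 : Type := UnitAddCircle

/-- The two-torus `ℝ² / ℤ²`. -/
abbrev T2 : Type := UnitAddCircle × UnitAddCircle

/-- The universal covering projection `ℝ² → 𝕋²`. -/
def proj (z : ℝ × ℝ) : T2 := ((z.1 : UnitAddCircle), (z.2 : UnitAddCircle))

/-- The standard scalar product on the plane. -/
def dot (u v : ℝ × ℝ) : ℝ := u.1 * v.1 + u.2 * v.2

/-- `F` is a lift of the torus homeomorphism `f` to the universal covering. -/
def IsLift (F : ℝ × ℝ → ℝ × ℝ) (f : T2 ≃ₜ T2) : Prop :=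
  Continuous F ∧ ∀ z, proj (F z) = f (proj z)

/-- Every nonempty open set meets one of its forward images under a positive iterate. -/
def IsNonwandering (f : T2 ≃ₜ T2) : Prop :=
  ∀ U : Set T2, IsOpen U → U.Nonempty → ∃ n : ℕ, 1 ≤ n ∧ ((f ^ n) '' U ∩ U).Nonempty

/-- Some lift has uniformly bounded displacement in the direction of a nonzero integer vector. -/
def IsAnnular (f : T2 ≃ₜ T2) : Prop :=
  ∃ (M : ℝ) (p q : ℤ) (F : ℝ × ℝ → ℝ × ℝ), 0 < M ∧ (p, q) ≠ (0, 0) ∧ IsLift F f ∧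
    ∀ (n : ℕ) (z : ℝ × ℝ), |dot (F^[n] z - z) ((p : ℝ), (q : ℝ))| < M

/-- Some positive iterate is annular. -/
def IsEventuallyAnnular (f : T2 ≃ₜ T2) : Prop :=
  ∃ k : ℕ, 1 ≤ k ∧ IsAnnular (f ^ k)

/-- The (Misiurewicz–Ziemian) rotation set of `F`: all limits of
`(F^{mᵢ}(zᵢ) - zᵢ) / mᵢ` with `mᵢ → ∞` and `zᵢ ∈ ℝ²`. -/
def rotationSet (F : ℝ × ℝ → ℝ × ℝ) : Set (ℝ × ℝ) :=
  ⋂ n : ℕ, closure (⋃ m ≥ n, range fun z : ℝ × ℝ => (m : ℝ)⁻¹ • (F^[m] z - z))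

/-- The rotation interval of `F` in the direction of `v`. -/
def rotationInterval (F : ℝ × ℝ → ℝ × ℝ) (v : ℝ × ℝ) : Set ℝ :=
  ⋂ n : ℕ, closure (⋃ m ≥ n, range fun z : ℝ × ℝ => dot (F^[m] z - z) v / m)

/-- Bounded deviations from a constant rotation in the direction of `v`. -/
def HasBoundedDeviations (F : ℝ × ℝ → ℝ × ℝ) (v : ℝ × ℝ) : Prop :=
  ∃ a : ℝ, rotationInterval F v = {a} ∧
    ∃ C : ℝ, 0 < C ∧ ∀ (n : ℕ) (z : ℝ × ℝ), |dot (F^[n] z - z) v - n * a| ≤ C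

/-- `f` is homotopic to the identity and stays, after lifting, at bounded distance from the
orbits of a translation. As `C` is existentially quantified, it does not matter that the norm
of `ℝ × ℝ` is the maximum norm rather than the Euclidean one. -/
def IsPseudoRotationBdd (f : T2 ≃ₜ T2) : Prop :=
  ContinuousMap.Homotopic (f : C(T2, T2)) (ContinuousMap.id T2) ∧
    ∃ (F : ℝ × ℝ → ℝ × ℝ) (ρ : ℝ × ℝ) (C : ℝ), IsLift F f ∧ 0 < C ∧
      ∀ (n : ℕ) (z : ℝ × ℝ), ‖F^[n] z - z - (n : ℝ) • ρ‖ ≤ C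

/-- There is a continuous surjection `h : 𝕋² → 𝕋¹` with `h ∘ f = R_α ∘ h`, where `R_α` is the
rotation of the circle by `α`. -/
def IsSemiconjugateToRotation (f : T2 ≃ₜ T2) (α : ℝ) : Prop :=
  ∃ h : T2 → T1, Continuous h ∧ Function.Surjective h ∧
    Function.Semiconj h f (fun x : T1 => x + (α : T1))

end TorusRotationFactor

/-! ### Crossing of paths in the plane. -/

open Set Topology
open scoped Pointwise

namespace TorusRotationFactor

open unitInterval

/-! View the orbits of a lift `Φ` in the frame moving with the horizontal speed, which `speed_eq`
identifies with `α`. By bounded deviations, `rightSet` at level `r` is open, connected, contains the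
half plane right of `r` and lies in the one right of `r - C`; `leftSet` is the region to its left.
`Φ` raises levels by `α`, and an integer translation raises them by its first coordinate. Hence
`level` is equivariant, and it descends to a semiconjugacy as soon as it is continuous.

Continuity depends on whether every strip between two levels contains a curve joining a point to a
nontrivial vertical integer translate of itself. If so, the periodic continuation of the curve
separates left from right (`periodic_cross`). The closure of each `leftSet` then lies in every
`leftSet` of higher level, which makes `level` continuous.

Otherwise some strip contains no such curve, and irrationality transports this to all thin strips.
Recurrence inside a thin strip yields a lift `g` of an iterate of `f` that shifts levels by a small
nonzero `η`, and a compact path connected `K` meeting `g '' K`. The `g`-orbit of `K` is a connected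
set running from far left to far right, of bounded height over bounded windows. If it met two
integer translates of itself, in one column but at different heights, at nearby levels, a forbidden
curve would result (`crossing_unique`). This forces `g` to commute with integer translations
(`twist_eq_zero`), then bounds the vertical oscillation of the orbit, and finally compares the
displacements of any two points (`exists_displacement_bound`). Displacement is thus additive up to a
bounded error, hence linear up to a bounded error, so an iterate of `f` is a pseudo-rotation with
bounded deviations, which is excluded. -/

/-- If `sin ∘ u` stays positive while `cos ∘ u` passes from negative to positive, then the
angle `u` decreases. -/
theorem angle_decreases {u : I → ℝ} (hu : Continuous u) (hsin : ∀ t, 0 < Real.sin (u t))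
    (h0 : Real.cos (u 0) < 0) (h1 : 0 < Real.cos (u 1)) : u 1 < u 0 := by
  by_contra! hle
  have hmem : ∀ x ∈ Icc (u 0) (u 1), 0 < Real.sin x := by
    intro x hx
    obtain ⟨t, rfl⟩ := mem_range_of_exists_le_of_exists_ge hu ⟨0, hx.1⟩ ⟨1, hx.2⟩
    exact hsin t
  have hanti : AntitoneOn Real.cos (Icc (u 0) (u 1)) := by
    refine antitoneOn_of_deriv_nonpos (convex_Icc _ _) Real.continuous_cos.continuousOn
      Real.differentiable_cos.differentiableOn fun x hx => ?_
    rw [Real.deriv_cos]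
    linarith [hmem x (interior_subset hx)]
  linarith [hanti (left_mem_Icc.2 hle) (right_mem_Icc.2 hle) hle]

/-- A path crossing a box from left to right meets every path crossing it from bottom to top. -/
theorem paths_cross {a₀ a₁ b₀ b₁ : ℝ × ℝ} (a : Path a₀ a₁) (b : Path b₀ b₁)
    (hl : ∀ s, a₀.1 < (b s).1) (hr : ∀ s, (b s).1 < a₁.1)
    (hb : ∀ t, b₀.2 < (a t).2) (ht : ∀ t, (a t).2 < b₁.2) : ∃ t s, a t = b s := by
  by_contra! hne
  -- If the paths are disjoint, the difference vector has a continuous angle `θ` on the square. Each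
  -- side confines the vector to a half plane, so the angle drops strictly along each: `θ (0,0) > θ
  -- (0,1) > θ (1,1) > θ (1,0) > θ (0,0)`.
  let D : I × I → ℂ := fun q => ⟨(a q.2).1 - (b q.1).1, (a q.2).2 - (b q.1).2⟩
  have hDc : Continuous D := by
    have : D = fun q : I × I => (((a q.2).1 - (b q.1).1 : ℝ) : ℂ)
        + (((a q.2).2 - (b q.1).2 : ℝ) : ℂ) * Complex.I := by
      funext q
      apply Complex.ext <;> simp [D]
    rw [this]
    fun_prop
  have hD0 : ∀ q, D q ≠ 0 := by
    intro q h
    apply hne q.2 q.1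
    have h1 := congrArg Complex.re h
    have h2 := congrArg Complex.im h
    simp only [D, Complex.zero_re, Complex.zero_im] at h1 h2
    exact Prod.ext (by linarith) (by linarith)
  let N : C(I × I, Circle) := ⟨fun q => ⟨D q / (‖D q‖ : ℂ), by
      rw [← SetLike.mem_coe, Submonoid.coe_unitSphere]
      simp [hD0 q]⟩, by
    refine Continuous.subtype_mk ?_ _
    exact hDc.div (by fun_prop) fun q => by simpa using hD0 q⟩
  -- Clamping extends the map to the plane, where the lifting theorem for the covering `Circle.exp`
  -- is applied.
  let P : C(ℝ × ℝ, I × I) :=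
    ⟨fun q => (projIcc 0 1 zero_le_one q.1, projIcc 0 1 zero_le_one q.2), by fun_prop⟩
  obtain ⟨e₀, he₀⟩ : ∃ e₀ : ℝ, Circle.exp e₀ = (N.comp P) (0, 0) := Circle.exp_surjective _
  obtain ⟨ϑ, ⟨-, hϑ⟩, -⟩ :=
    Circle.isCoveringMap_exp.existsUnique_continuousMap_lifts (N.comp P) (0, 0) e₀ he₀
  let θ : C(I × I, ℝ) := ⟨fun q => ϑ ((q.1 : ℝ), (q.2 : ℝ)), by fun_prop⟩
  have hθ : ∀ q, Circle.exp (θ q) = N q := fun q => by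
    have h := congrFun hϑ ((q.1 : ℝ), (q.2 : ℝ))
    have hP : P ((q.1 : ℝ), (q.2 : ℝ)) = q :=
      Prod.ext (projIcc_val zero_le_one q.1) (projIcc_val zero_le_one q.2)
    simp only [Function.comp_apply, ContinuousMap.comp_apply, hP] at h
    exact h
  have key : ∀ q, (D q).re = ‖D q‖ * Real.cos (θ q) ∧ (D q).im = ‖D q‖ * Real.sin (θ q) := by
    intro q
    have h1 : (Circle.exp (θ q) : ℂ) = D q / (‖D q‖ : ℂ) := by
      rw [hθ q]
      rfl
    have h2 : D q = (‖D q‖ : ℂ) * Complex.exp (θ q * Complex.I) := by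
      rw [← Circle.coe_exp, h1]
      have : (‖D q‖ : ℂ) ≠ 0 := by simpa using hD0 q
      field_simp
    rw [Complex.exp_mul_I, ← Complex.ofReal_cos, ← Complex.ofReal_sin] at h2
    constructor
    · have := congrArg Complex.re h2
      simpa [← Complex.ofReal_cos, ← Complex.ofReal_sin, -Complex.ofReal_cos,
        -Complex.ofReal_sin] using this
    · have := congrArg Complex.im h2
      simpa [← Complex.ofReal_cos, ← Complex.ofReal_sin, -Complex.ofReal_cos,
        -Complex.ofReal_sin] using this
  have hpos : ∀ q, 0 < ‖D q‖ := fun q => norm_pos_iff.2 (hD0 q)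
  have cpos : ∀ q, 0 < (D q).re → 0 < Real.cos (θ q) := fun q h => by
    rw [(key q).1] at h; exact pos_of_mul_pos_right h (hpos q).le
  have cneg : ∀ q, (D q).re < 0 → Real.cos (θ q) < 0 := fun q h => by
    rw [(key q).1] at h; exact neg_of_mul_neg_right h (hpos q).le
  have spos : ∀ q, 0 < (D q).im → 0 < Real.sin (θ q) := fun q h => by
    rw [(key q).2] at h; exact pos_of_mul_pos_right h (hpos q).le
  have sneg : ∀ q, (D q).im < 0 → Real.sin (θ q) < 0 := fun q h => by
    rw [(key q).2] at h; exact neg_of_mul_neg_right h (hpos q).le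
  have left : ∀ s : I, Real.cos (θ (s, 0)) < 0 := fun s => cneg _ (by
    simpa [D] using hl s)
  have right : ∀ s : I, 0 < Real.cos (θ (s, 1)) := fun s => cpos _ (by
    simpa [D] using hr s)
  have bot : ∀ t : I, 0 < Real.sin (θ (0, t)) := fun t => spos _ (by
    simpa [D] using hb t)
  have top : ∀ t : I, Real.sin (θ (1, t)) < 0 := fun t => sneg _ (by
    simpa [D] using ht t)
  have hθc : Continuous θ := θ.continuous
  have s1 : θ (0, 1) < θ (0, 0) :=
    angle_decreases (u := fun t => θ (0, t)) (by fun_prop) bot (left 0) (right 0)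
  -- A rotation by a multiple of `π / 2` turns each remaining side into the first case; `σ` reverses
  -- the two sides traversed backwards.
  have s2 : θ (1, 1) < θ (0, 1) := by
    have := angle_decreases (u := fun s => θ (s, 1) + Real.pi / 2) (by fun_prop)
      (fun s => by rw [Real.sin_add_pi_div_two]; exact right s)
      (by rw [Real.cos_add_pi_div_two]; linarith [bot 1])
      (by rw [Real.cos_add_pi_div_two]; linarith [top 1])
    linarith
  have s3 : θ (1, 0) < θ (1, 1) := by
    have := angle_decreases (u := fun s => θ (1, σ s) + Real.pi) (by fun_prop)
      (fun s => by rw [Real.sin_add_pi]; linarith [top (σ s)])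
      (by rw [Real.cos_add_pi, symm_zero]; linarith [right 1])
      (by rw [Real.cos_add_pi, symm_one]; linarith [left 1])
    simp only [symm_zero, symm_one] at this
    linarith
  have s4 : θ (0, 0) < θ (1, 0) := by
    have := angle_decreases (u := fun s => θ (σ s, 0) - Real.pi / 2) (by fun_prop)
      (fun s => by rw [Real.sin_sub_pi_div_two]; linarith [left (σ s)])
      (by rw [Real.cos_sub_pi_div_two, symm_zero]; linarith [top 0])
      (by rw [Real.cos_sub_pi_div_two, symm_one]; linarith [bot 0])
    simp only [symm_zero, symm_one] at this
    linarith
  linarith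

/-- The vertical segment between two points with the same first coordinate. -/
theorem joinedIn_vertical {S : Set (ℝ × ℝ)} {x y y' : ℝ}
    (h : ∀ t ∈ uIcc y y', (x, t) ∈ S) : JoinedIn S (x, y) (x, y') := by
  have hpc : IsPathConnected (uIcc y y') :=
    (convex_uIcc y y').isPathConnected nonempty_uIcc
  have hj := (hpc.joinedIn y left_mem_uIcc y' right_mem_uIcc).map
    (f := fun t : ℝ => (x, t)) (by fun_prop)
  exact hj.mono (by rintro _ ⟨t, ht, rfl⟩; exact h t ht)

/-- A path that starts below and ends above a left-to-right barrier, and stays in the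
vertical band spanned by the barrier, meets it. -/
theorem joinedIn_cross {X Y : Set (ℝ × ℝ)} {a₀ a₁ b₀ b₁ : ℝ × ℝ} {l r : ℝ}
    (hX : JoinedIn X a₀ a₁) (hY : JoinedIn Y b₀ b₁)
    (hl : a₀.1 < l) (hr : r < a₁.1) (hYl : ∀ z ∈ Y, l ≤ z.1) (hYr : ∀ z ∈ Y, z.1 ≤ r)
    (hb : ∀ z ∈ X, l ≤ z.1 → z.1 ≤ r → b₀.2 < z.2)
    (ht : ∀ z ∈ X, l ≤ z.1 → z.1 ≤ r → z.2 < b₁.2) : (X ∩ Y).Nonempty := by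
  let a := hX.somePath
  obtain ⟨M, hM⟩ : ∃ M : ℝ, ∀ t, |(a t).2| ≤ M := by
    obtain ⟨M, hM⟩ := (isCompact_range (f := fun t => |(a t).2|)
      (by fun_prop)).bddAbove
    exact ⟨M, fun t => hM ⟨t, rfl⟩⟩
  -- Vertical segments attached to both ends of the second path take it beyond the vertical range of
  -- the first. By `hb` and `ht` the first path misses these segments.
  set lo := min b₀.2 (-M - 1)
  set hi := max b₁.2 (M + 1)
  let Z : Set (ℝ × ℝ) := Y ∪ ({z | z.1 = b₀.1 ∧ z.2 ≤ b₀.2} ∪ {z | z.1 = b₁.1 ∧ b₁.2 ≤ z.2})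
  have j1 : JoinedIn Z (b₀.1, lo) b₀ := by
    have : JoinedIn Z (b₀.1, lo) (b₀.1, b₀.2) := joinedIn_vertical fun t ht => by
      rw [uIcc_of_le (min_le_left _ _)] at ht
      exact Or.inr (Or.inl ⟨rfl, ht.2⟩)
    exact this
  have j3 : JoinedIn Z b₁ (b₁.1, hi) := by
    have : JoinedIn Z (b₁.1, b₁.2) (b₁.1, hi) := joinedIn_vertical fun t ht => by
      rw [uIcc_of_le (le_max_left _ _)] at ht
      exact Or.inr (Or.inr ⟨rfl, ht.1⟩)
    exact this
  have j := (j1.trans (hY.mono subset_union_left)).trans j3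
  have hZ : ∀ z ∈ Z, l ≤ z.1 ∧ z.1 ≤ r := by
    rintro z (hz | ⟨hz, -⟩ | ⟨hz, -⟩)
    · exact ⟨hYl z hz, hYr z hz⟩
    · rw [hz]; exact ⟨hYl _ hY.source_mem, hYr _ hY.source_mem⟩
    · rw [hz]; exact ⟨hYl _ hY.target_mem, hYr _ hY.target_mem⟩
  obtain ⟨t, s, hts⟩ := paths_cross a j.somePath
    (fun s => hl.trans_le (hZ _ (j.somePath_mem s)).1)
    (fun s => (hZ _ (j.somePath_mem s)).2.trans_lt hr)
    (fun t => by
      have := abs_le.1 (hM t)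
      have h2 : lo ≤ -M - 1 := min_le_right _ _
      show lo < _
      linarith)
    (fun t => by
      have := abs_le.1 (hM t)
      have h2 : M + 1 ≤ hi := le_max_right _ _
      show _ < hi
      linarith)
  have hx : a t ∈ X := hX.somePath_mem t
  have hz : a t ∈ Z := hts ▸ j.somePath_mem s
  have hlr := hZ _ hz
  rcases hz with hz | ⟨-, hz⟩ | ⟨-, hz⟩
  · exact ⟨a t, hx, hz⟩
  · exact absurd (hb _ hx hlr.1 hlr.2) (not_lt.2 hz)
  · exact absurd (ht _ hx hlr.1 hlr.2) (not_lt.2 hz)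

end TorusRotationFactor

/-! ### Level sets in the moving frame. -/

namespace TorusRotationFactor

/-- Bounded horizontal deviations of all iterates of `Φ` from the translation by `α`. -/
def HasHorizontalBound (Φ : (ℝ × ℝ) ≃ₜ (ℝ × ℝ)) (α C : ℝ) : Prop :=
  ∀ (n : ℤ) (z : ℝ × ℝ), |((Φ ^ n) z).1 - z.1 - n * α| ≤ C

/-- `Ψ` intertwines integer translations through the matrix with rows `(1, 0)` and `(c, d)`. -/
def ActsOnLattice (Ψ : (ℝ × ℝ) ≃ₜ (ℝ × ℝ)) (c d : ℤ) : Prop :=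
  ∀ (z : ℝ × ℝ) (m k : ℤ),
    Ψ (z + ((m : ℝ), (k : ℝ))) = Ψ z + ((m : ℝ), ((c * m + d * k : ℤ) : ℝ))

/-- The points whose orbit, seen in the frame moving with speed `α`, passes to the right
of `r`. -/
def rightSet (Φ : (ℝ × ℝ) ≃ₜ (ℝ × ℝ)) (α r : ℝ) : Set (ℝ × ℝ) :=
  {z | ∃ n : ℤ, r < ((Φ ^ n) z).1 - n * α}

/-- The component of the exterior of `rightSet` that contains a left half plane. -/
def leftSet (Φ : (ℝ × ℝ) ≃ₜ (ℝ × ℝ)) (α C r : ℝ) : Set (ℝ × ℝ) :=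
  connectedComponentIn (closure (rightSet Φ α r))ᶜ (r - C - 1, 0)

/-- The open region between the boundaries at levels `r` and `s`. -/
def strip (Φ : (ℝ × ℝ) ≃ₜ (ℝ × ℝ)) (α C r s : ℝ) : Set (ℝ × ℝ) :=
  leftSet Φ α C s ∩ rightSet Φ α r

/-- `Ψ` raises the level of the sets `rightSet` by `t`. -/
def IsShift (Φ : (ℝ × ℝ) ≃ₜ (ℝ × ℝ)) (α : ℝ) (Ψ : (ℝ × ℝ) ≃ₜ (ℝ × ℝ)) (t : ℝ) : Prop :=
  ∀ r z, z ∈ rightSet Φ α r ↔ Ψ z ∈ rightSet Φ α (r + t)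

theorem ActsOnLattice.mul {Ψ Ψ' : (ℝ × ℝ) ≃ₜ (ℝ × ℝ)} {c d c' d' : ℤ}
    (h : ActsOnLattice Ψ c d) (h' : ActsOnLattice Ψ' c' d') :
    ActsOnLattice (Ψ * Ψ') (c + d * c') (d * d') := by
  intro z m k
  rw [Homeomorph.mul_apply, h', h, Homeomorph.mul_apply]
  congr 3
  ring

theorem ActsOnLattice.inv {Ψ : (ℝ × ℝ) ≃ₜ (ℝ × ℝ)} {c d : ℤ}
    (h : ActsOnLattice Ψ c d) (hd : d * d = 1) : ActsOnLattice Ψ⁻¹ (-(d * c)) d := by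
  intro z m k
  rw [Homeomorph.inv_apply, Homeomorph.inv_apply, Homeomorph.symm_apply_eq, h,
    Homeomorph.apply_symm_apply]
  congr 3
  linear_combination (m * c - k) * hd

theorem ActsOnLattice.pow {Ψ : (ℝ × ℝ) ≃ₜ (ℝ × ℝ)} {c d : ℤ} (h : ActsOnLattice Ψ c d)
    (hd : d * d = 1) (n : ℕ) : ∃ c' d' : ℤ, d' * d' = 1 ∧ ActsOnLattice (Ψ ^ n) c' d' := by
  induction n with
  | zero => exact ⟨0, 1, by simp, fun z m k => by simp⟩
  | succ n ih =>
    obtain ⟨c', d', hd', hh⟩ := ih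
    exact ⟨_, _, by rw [mul_mul_mul_comm, hd', hd, one_mul], pow_succ Ψ n ▸ hh.mul h⟩

theorem ActsOnLattice.zpow {Ψ : (ℝ × ℝ) ≃ₜ (ℝ × ℝ)} {c d : ℤ} (h : ActsOnLattice Ψ c d)
    (hd : d * d = 1) (n : ℤ) : ∃ c' d' : ℤ, d' * d' = 1 ∧ ActsOnLattice (Ψ ^ n) c' d' := by
  obtain ⟨k, rfl | rfl⟩ := n.eq_nat_or_neg
  · simpa using h.pow hd k
  · obtain ⟨c', d', hd', hh⟩ := h.pow hd k
    exact ⟨_, _, hd', by simpa using hh.inv hd'⟩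

/-- Powers of a map with vertical part `d = 1`. -/
theorem ActsOnLattice.zpow_one {Ψ : (ℝ × ℝ) ≃ₜ (ℝ × ℝ)} {c : ℤ} (h : ActsOnLattice Ψ c 1)
    (n : ℤ) : ActsOnLattice (Ψ ^ n) (n * c) 1 := by
  induction n with
  | zero => intro z m k; simp
  | succ n ih =>
    rw [zpow_add_one]
    convert ih.mul h using 1 <;> ring
  | pred n ih =>
    rw [zpow_sub_one]
    convert ih.mul (h.inv (by ring)) using 1 <;> ring

variable {Φ : (ℝ × ℝ) ≃ₜ (ℝ × ℝ)} {α C : ℝ}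

theorem HasHorizontalBound.nonneg (hb : HasHorizontalBound Φ α C) : 0 ≤ C :=
  (abs_nonneg _).trans (hb 0 0)

theorem IsShift.mul {Ψ Ψ' : (ℝ × ℝ) ≃ₜ (ℝ × ℝ)} {t t' : ℝ} (h : IsShift Φ α Ψ t)
    (h' : IsShift Φ α Ψ' t') : IsShift Φ α (Ψ * Ψ') (t + t') := by
  intro r z
  rw [h' r z, h (r + t') (Ψ' z), Homeomorph.mul_apply, add_assoc, add_comm t' t]

theorem IsShift.inv {Ψ : (ℝ × ℝ) ≃ₜ (ℝ × ℝ)} {t : ℝ} (h : IsShift Φ α Ψ t) :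
    IsShift Φ α Ψ⁻¹ (-t) := by
  intro r z
  rw [h (r + -t) (Ψ⁻¹ z), Homeomorph.inv_apply, Homeomorph.apply_symm_apply,
    neg_add_cancel_right]

theorem IsShift.one : IsShift Φ α 1 0 := fun r z => by simp

theorem IsShift.zpow {Ψ : (ℝ × ℝ) ≃ₜ (ℝ × ℝ)} {t : ℝ} (h : IsShift Φ α Ψ t) (n : ℤ) :
    IsShift Φ α (Ψ ^ n) (n * t) := by
  induction n with
  | zero => simpa using IsShift.one
  | succ n ih =>
    rw [zpow_add_one]
    convert ih.mul h using 1
    push_cast; ring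
  | pred n ih =>
    rw [zpow_sub_one]
    convert ih.mul h.inv using 1
    push_cast; ring

theorem isShift_self : IsShift Φ α Φ α := by
  intro r z
  constructor
  · rintro ⟨n, hn⟩
    refine ⟨n - 1, ?_⟩
    rw [← Homeomorph.mul_apply, ← zpow_add_one, sub_add_cancel]
    push_cast
    linarith
  · rintro ⟨n, hn⟩
    refine ⟨n + 1, ?_⟩
    rw [← Homeomorph.mul_apply, ← zpow_add_one] at hn
    push_cast
    linarith

/-- Every iterate of `Φ` acts on the lattice with first row `(1, 0)`, so the whole orbit moves
horizontally by exactly `m`. -/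
theorem isShift_translation {c d : ℤ} (hΦ : ActsOnLattice Φ c d) (hd : d * d = 1) (m k : ℤ) :
    IsShift Φ α (Homeomorph.addRight ((m : ℝ), (k : ℝ))) m := by
  intro r z
  refine exists_congr fun n => ?_
  obtain ⟨c', d', -, h⟩ := hΦ.zpow hd n
  rw [Homeomorph.coe_addRight, h, Prod.fst_add]
  constructor <;> intro h <;> linarith

theorem isOpen_rightSet (r : ℝ) : IsOpen (rightSet Φ α r) := by
  have : rightSet Φ α r = ⋃ n : ℤ, {z | r < ((Φ ^ n) z).1 - n * α} := by
    ext z; simp [rightSet]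
  rw [this]
  exact isOpen_iUnion fun n => isOpen_lt continuous_const
    ((continuous_fst.comp (Φ ^ n).continuous).sub continuous_const)

theorem rightSet_anti {r s : ℝ} (h : r ≤ s) : rightSet Φ α s ⊆ rightSet Φ α r :=
  fun _ ⟨n, hn⟩ => ⟨n, h.trans_lt hn⟩

theorem mem_rightSet_of_lt {r : ℝ} {z : ℝ × ℝ} (h : r < z.1) : z ∈ rightSet Φ α r :=
  ⟨0, by simpa using h⟩

theorem lt_of_mem_rightSet (hb : HasHorizontalBound Φ α C) {r : ℝ} {z : ℝ × ℝ}
    (h : z ∈ rightSet Φ α r) : r - C < z.1 := by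
  obtain ⟨n, hn⟩ := h
  have := abs_le.1 (hb n z)
  linarith

theorem le_of_mem_closure_rightSet (hb : HasHorizontalBound Φ α C) {r : ℝ} {z : ℝ × ℝ}
    (h : z ∈ closure (rightSet Φ α r)) : r - C ≤ z.1 := by
  have hcl : IsClosed {z : ℝ × ℝ | r - C ≤ z.1} := isClosed_le continuous_const continuous_fst
  exact closure_minimal (fun w hw => (lt_of_mem_rightSet hb hw).le) hcl h

/-- A shift displaces points horizontally by its level up to the deviation bound. -/
theorem IsShift.abs_le (hb : HasHorizontalBound Φ α C) {Ψ : (ℝ × ℝ) ≃ₜ (ℝ × ℝ)} {t : ℝ}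
    (h : IsShift Φ α Ψ t) (z : ℝ × ℝ) : |(Ψ z).1 - z.1 - t| ≤ C := by
  rw [_root_.abs_le]
  constructor
  · refine le_of_forall_pos_lt_add fun ε hε => ?_
    have := lt_of_mem_rightSet hb ((h (z.1 - ε) z).1 (mem_rightSet_of_lt (by linarith)))
    linarith
  · refine le_of_forall_pos_lt_add fun ε hε => ?_
    have := lt_of_mem_rightSet hb ((h ((Ψ z).1 - t - ε) z).2 (mem_rightSet_of_lt (by linarith)))
    linarith

/-- The set is a union of homeomorphic preimages of half planes, and the deviation bound puts `(r +
C + 1, 0)` in all of them. -/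
theorem isPathConnected_rightSet (hb : HasHorizontalBound Φ α C) (r : ℝ) :
    IsPathConnected (rightSet Φ α r) := by
  refine (isOpen_rightSet r).isConnected_iff_isPathConnected.1
    ⟨⟨(r + 1, 0), mem_rightSet_of_lt (by simp)⟩, ?_⟩
  have : rightSet Φ α r = ⋃ n : ℤ, (Φ ^ n) ⁻¹' {z | r + n * α < z.1} := by
    ext z; simp [rightSet, lt_sub_iff_add_lt]
  rw [this]
  refine isPreconnected_iUnion ⟨(r + C + 1, 0), ?_⟩ fun n => ?_
  · simp only [mem_iInter, mem_preimage, mem_ofPred_eq]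
    intro n
    have := abs_le.1 (hb n (r + C + 1, 0))
    simp only at this
    linarith
  · rw [Homeomorph.isPreconnected_preimage]
    have hc : Convex ℝ {z : ℝ × ℝ | r + n * α < z.1} :=
      convex_halfSpace_gt (IsLinearMap.mk (fun _ _ => rfl) (fun _ _ => rfl)) _
    exact hc.isPreconnected

theorem base_mem (hb : HasHorizontalBound Φ α C) {r : ℝ} {z : ℝ × ℝ} (hz : z.1 < r - C) :
    z ∈ (closure (rightSet Φ α r))ᶜ :=
  fun h => absurd (le_of_mem_closure_rightSet hb h) (not_le.2 hz)

theorem mem_leftSet_of_lt (hb : HasHorizontalBound Φ α C) {r : ℝ} {z : ℝ × ℝ}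
    (hz : z.1 < r - C) : z ∈ leftSet Φ α C r := by
  have hc : Convex ℝ {z : ℝ × ℝ | z.1 < r - C} :=
    convex_halfSpace_lt (IsLinearMap.mk (fun _ _ => rfl) (fun _ _ => rfl)) _
  exact hc.isPreconnected.subset_connectedComponentIn (x := (r - C - 1, 0)) (by simp)
    (fun w hw => base_mem hb hw) hz

theorem leftSet_eq (hb : HasHorizontalBound Φ α C) {r : ℝ} {z : ℝ × ℝ} (hz : z.1 < r - C) :
    leftSet Φ α C r = connectedComponentIn (closure (rightSet Φ α r))ᶜ z :=
  connectedComponentIn_eq (mem_leftSet_of_lt hb hz)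

theorem isOpen_leftSet (r : ℝ) : IsOpen (leftSet Φ α C r) :=
  isClosed_closure.isOpen_compl.connectedComponentIn

theorem isPathConnected_leftSet (hb : HasHorizontalBound Φ α C) (r : ℝ) :
    IsPathConnected (leftSet Φ α C r) :=
  (isOpen_leftSet r).isConnected_iff_isPathConnected.1
    (isConnected_connectedComponentIn_iff.2 (base_mem hb (by simp)))

theorem notMem_closure_of_mem_leftSet {r : ℝ} {z : ℝ × ℝ} (hz : z ∈ leftSet Φ α C r) :
    z ∉ closure (rightSet Φ α r) :=
  connectedComponentIn_subset _ _ hz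

theorem notMem_rightSet_of_mem_leftSet {r : ℝ} {z : ℝ × ℝ} (hz : z ∈ leftSet Φ α C r) :
    z ∉ rightSet Φ α r :=
  fun h => notMem_closure_of_mem_leftSet hz (subset_closure h)

theorem le_of_mem_leftSet {r : ℝ} {z : ℝ × ℝ} (hz : z ∈ leftSet Φ α C r) : z.1 ≤ r :=
  not_lt.1 fun h => notMem_rightSet_of_mem_leftSet hz (mem_rightSet_of_lt h)

theorem leftSet_mono (hb : HasHorizontalBound Φ α C) {r s : ℝ} (h : r ≤ s) :
    leftSet Φ α C r ⊆ leftSet Φ α C s := by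
  have hz : ((r - C - 1, 0) : ℝ × ℝ).1 < s - C := by simp only; linarith
  rw [leftSet_eq hb hz]
  exact connectedComponentIn_mono _ (compl_subset_compl.2 (closure_mono (rightSet_anti h)))

theorem lt_of_mem_left_right {r s : ℝ} {z : ℝ × ℝ} (hl : z ∈ leftSet Φ α C s)
    (hr : z ∈ rightSet Φ α r) : r < s :=
  not_le.1 fun h => notMem_rightSet_of_mem_leftSet hl (rightSet_anti h hr)

/-- Components of the open exterior are open, so a frontier point lying in the exterior would belong
to the same component, which contains none of its frontier points. -/
theorem frontier_leftSet_subset {r : ℝ} :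
    frontier (leftSet Φ α C r) ⊆ closure (rightSet Φ α r) := by
  intro z hz
  by_contra hn
  have hz' : z ∈ (closure (rightSet Φ α r))ᶜ := hn
  have hop : IsOpen (connectedComponentIn (closure (rightSet Φ α r))ᶜ z) :=
    isClosed_closure.isOpen_compl.connectedComponentIn
  obtain ⟨w, hw, hw'⟩ := mem_closure_iff.1 hz.1 _ hop (mem_connectedComponentIn hz')
  have e1 := connectedComponentIn_eq hw
  have e2 := connectedComponentIn_eq hw'
  have : z ∈ leftSet Φ α C r := by
    rw [leftSet, e2, ← e1]
    exact mem_connectedComponentIn hz'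
  rw [(isOpen_leftSet r).frontier_eq] at hz
  exact hz.2 this

theorem IsShift.mem_leftSet_iff (hb : HasHorizontalBound Φ α C) {Ψ : (ℝ × ℝ) ≃ₜ (ℝ × ℝ)} {t : ℝ}
    (h : IsShift Φ α Ψ t) (r : ℝ) (z : ℝ × ℝ) :
    z ∈ leftSet Φ α C r ↔ Ψ z ∈ leftSet Φ α C (r + t) := by
  have him : Ψ '' (closure (rightSet Φ α r))ᶜ = (closure (rightSet Φ α (r + t)))ᶜ := by
    rw [image_compl_eq Ψ.bijective, Ψ.image_closure]
    congr 2
    ext w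
    rw [← Ψ.apply_symm_apply w, Ψ.injective.mem_set_image, h r, Ψ.apply_symm_apply]
  have hC := hb.nonneg
  -- The extra `C` pays for the displacement under `Ψ`, so that the image of the base point also
  -- lies in the left half plane of its level.
  have hz : ((r - 2 * C - 1, 0) : ℝ × ℝ).1 < r - C := by simp only; linarith
  have hz' : (Ψ (r - 2 * C - 1, 0)).1 < r + t - C := by
    have := _root_.abs_le.1 (h.abs_le hb (r - 2 * C - 1, 0))
    simp only at this
    linarith
  rw [leftSet_eq hb hz, leftSet_eq hb hz', ← him,
    ← Ψ.image_connectedComponentIn (base_mem hb hz), Ψ.injective.mem_set_image]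

theorem IsShift.mem_strip_iff (hb : HasHorizontalBound Φ α C) {Ψ : (ℝ × ℝ) ≃ₜ (ℝ × ℝ)} {t : ℝ}
    (h : IsShift Φ α Ψ t) (r s : ℝ) (z : ℝ × ℝ) :
    z ∈ strip Φ α C r s ↔ Ψ z ∈ strip Φ α C (r + t) (s + t) :=
  and_congr (h.mem_leftSet_iff hb s z) (h r z)

theorem strip_mono (hb : HasHorizontalBound Φ α C) {r s r' s' : ℝ} (hr : r' ≤ r) (hs : s ≤ s') :
    strip Φ α C r s ⊆ strip Φ α C r' s' :=
  inter_subset_inter (leftSet_mono hb hs) (rightSet_anti hr)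

theorem isOpen_strip (r s : ℝ) : IsOpen (strip Φ α C r s) :=
  (isOpen_leftSet s).inter (isOpen_rightSet r)

/-- The numbers `n * α + m` are dense. -/
theorem exists_int_mul_add_mem_Ioo (hα : Irrational α) {x y : ℝ} (hxy : x < y) :
    ∃ n m : ℤ, n * α + m ∈ Ioo x y := by
  have hd : Dense (AddSubgroup.closure {α, 1} : Set ℝ) :=
    dense_addSubgroupClosure_pair_iff.2 (by simpa using hα)
  obtain ⟨z, hz, hz'⟩ := hd.exists_mem_open isOpen_Ioo (nonempty_Ioo.2 hxy)
  obtain ⟨n, m, rfl⟩ := AddSubgroup.mem_closure_pair.1 hz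
  exact ⟨n, m, by simpa using hz'⟩

/-- The maps `z ↦ Φ ^ n z + (m, 0)` shift levels by `n * α + m`. -/
theorem exists_shift {c d : ℤ} (hΦ : ActsOnLattice Φ c d) (hd : d * d = 1) (n m : ℤ) :
    ∃ (Ψ : (ℝ × ℝ) ≃ₜ (ℝ × ℝ)) (c' d' : ℤ), d' * d' = 1 ∧ ActsOnLattice Ψ c' d' ∧
      IsShift Φ α Ψ (n * α + m) := by
  obtain ⟨c', d', hd', h⟩ := hΦ.zpow hd n
  refine ⟨Homeomorph.addRight ((m : ℝ), ((0 : ℤ) : ℝ)) * Φ ^ n, c', d', hd', ?_, ?_⟩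
  · intro z m' k
    simp only [Homeomorph.mul_apply, h z m' k, Homeomorph.coe_addRight]
    abel
  · convert (isShift_translation hΦ hd m 0).mul (isShift_self.zpow n) using 1
    ring

/-- An empty strip would make `leftSet` constant between its two levels. The dense shifts `n * α +
m` carry this to every level, so `leftSet` would never grow, although it eventually contains `(1,
0)`. Steps of half the width leave room for the choice of the shift. -/
theorem strip_nonempty (hb : HasHorizontalBound Φ α C) {c d : ℤ} (hΦ : ActsOnLattice Φ c d)
    (hd : d * d = 1) (hα : Irrational α) {r s : ℝ} (hrs : r < s) :
    (strip Φ α C r s).Nonempty := by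
  by_contra hne
  rw [not_nonempty_iff_eq_empty] at hne
  have heq : leftSet Φ α C s ⊆ leftSet Φ α C r := by
    have hd : Disjoint (leftSet Φ α C s) (closure (rightSet Φ α r)) :=
      Disjoint.closure_right (disjoint_iff_inter_eq_empty.2 hne) (isOpen_leftSet s)
    exact (isPathConnected_leftSet hb s).isConnected.isPreconnected.subset_connectedComponentIn
      (leftSet_mono hb hrs.le (mem_connectedComponentIn (base_mem hb (by simp))))
      (fun w hw hw' => Set.disjoint_left.1 hd hw hw')
  have hC := hb.nonneg
  set δ := (s - r) / 2
  have hδ : 0 < δ := by simp only [δ]; linarith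
  have step : ∀ u, leftSet Φ α C (u + δ) ⊆ leftSet Φ α C u := by
    intro u z hz
    obtain ⟨n, m, h1, h2⟩ := exists_int_mul_add_mem_Ioo hα (x := r - u) (y := r - u + δ)
      (by linarith)
    obtain ⟨Ψ, c', d', -, -, hΨ⟩ := exists_shift (α := α) hΦ hd n m
    rw [hΨ.mem_leftSet_iff hb] at hz ⊢
    refine leftSet_mono hb ?_ (heq (leftSet_mono hb ?_ hz))
    · linarith
    · simp only [δ] at h2 ⊢; linarith
  have all : ∀ k : ℕ, leftSet Φ α C (0 + k * δ) ⊆ leftSet Φ α C 0 := by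
    intro k
    induction k with
    | zero => simp
    | succ k ih =>
      refine subset_trans ?_ ih
      have h : (0 : ℝ) + ((k + 1 : ℕ) : ℝ) * δ = 0 + k * δ + δ := by push_cast; ring
      exact h ▸ step (0 + k * δ)
  obtain ⟨k, hk⟩ := exists_nat_gt ((C + 1) / δ)
  rw [div_lt_iff₀ hδ] at hk
  have := le_of_mem_leftSet (all k (mem_leftSet_of_lt hb (z := (1, 0)) (by simp only; linarith)))
  norm_num at this

end TorusRotationFactor

/-! ### Essential curves in all strips make the level continuous. -/

namespace TorusRotationFactor

/-- The union of all translates of `K` by vectors `(0, k)` with `k` an integer. -/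
def verticalSaturation (K : Set (ℝ × ℝ)) : Set (ℝ × ℝ) :=
  {z | ∃ k : ℤ, z + (0, (k : ℝ)) ∈ K}

theorem isClosed_verticalSaturation {K : Set (ℝ × ℝ)} (hK : IsCompact K) :
    IsClosed (verticalSaturation K) := by
  have hZ : IsClosed ({0} ×ˢ range ((↑) : ℤ → ℝ) : Set (ℝ × ℝ)) :=
    isClosed_singleton.prod Int.isClosedEmbedding_coe_real.isClosed_range
  have : verticalSaturation K = ({0} ×ˢ range ((↑) : ℤ → ℝ) : Set (ℝ × ℝ)) + K := by
    ext z
    constructor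
    · rintro ⟨k, hk⟩
      exact ⟨(0, ((-k : ℤ) : ℝ)), ⟨rfl, mem_range_self _⟩, _, hk, by ext <;> simp⟩
    · rintro ⟨⟨_, _⟩, ⟨rfl, k, rfl⟩, w, hw, rfl⟩
      refine ⟨-k, ?_⟩
      convert hw using 1
      ext <;> simp
  rw [this]
  exact hZ.add_right_of_isCompact hK

theorem subset_verticalSaturation (K : Set (ℝ × ℝ)) : K ⊆ verticalSaturation K :=
  fun z hz => ⟨0, by convert hz using 1; ext <;> simp⟩

theorem joinedIn_translate {S S' : Set (ℝ × ℝ)} {p q v : ℝ × ℝ} (h : JoinedIn S p q)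
    (hS : ∀ z ∈ S, z + v ∈ S') : JoinedIn S' (p + v) (q + v) :=
  (h.map (f := fun z => z + v) (by fun_prop)).mono
    (by rintro _ ⟨z, hz, rfl⟩; exact hS z hz)

theorem verticalSaturation_add {K : Set (ℝ × ℝ)} {z : ℝ × ℝ} (hz : z ∈ verticalSaturation K)
    (k : ℤ) : z + (0, (k : ℝ)) ∈ verticalSaturation K := by
  obtain ⟨j, hj⟩ := hz
  refine ⟨j - k, ?_⟩
  convert hj using 1
  ext <;> simp

/-- A curve joining a point to a vertical translate of itself, continued periodically,
separates left from right. -/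
theorem periodic_cross {K X : Set (ℝ × ℝ)} {p a₀ a₁ : ℝ × ℝ} {l : ℤ} {R : ℝ} (hl : l ≠ 0)
    (hK : JoinedIn K p (p + (0, (l : ℝ)))) (hR : ∀ z ∈ K, |z.1| ≤ R)
    (hX : JoinedIn X a₀ a₁) (h₀ : a₀.1 < -R) (h₁ : R < a₁.1) :
    (X ∩ verticalSaturation K).Nonempty := by
  wlog hpos : 0 < l generalizing l p
  · refine this (p := p + (0, (l : ℝ))) (l := -l) (by omega) ?_ (by omega)
    convert hK.symm using 1
    ext <;> simp
  set S := verticalSaturation K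
  have hS1 : JoinedIn S p (p + (0, (l : ℝ))) := hK.mono (subset_verticalSaturation K)
  have hSN : ∀ N : ℕ, JoinedIn S p (p + (0, ((N * l : ℤ) : ℝ))) := by
    intro N
    induction N with
    | zero =>
      convert JoinedIn.refl hS1.source_mem using 1
      ext <;> simp
    | succ N ih =>
      refine ih.trans ?_
      convert joinedIn_translate hS1 (v := (0, ((N * l : ℤ) : ℝ)))
        (fun z hz => verticalSaturation_add hz _) using 1
      ext
      · simp
      · simp; ring
  let a := hX.somePath
  obtain ⟨M, hM⟩ : ∃ M : ℝ, ∀ t, |(a t).2| ≤ M := by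
    obtain ⟨M, hM⟩ := (isCompact_range (f := fun t => |(a t).2|)
      (by fun_prop)).bddAbove
    exact ⟨M, fun t => hM ⟨t, rfl⟩⟩
  -- The continued curve from `p - (0, N * l)` to `p + (0, N * l)` now extends above and below the
  -- path `a`.
  obtain ⟨N, hN⟩ := exists_nat_gt (M + |p.2|)
  have hNl : (N : ℝ) ≤ ((N * l : ℤ) : ℝ) := by
    have : (N : ℤ) ≤ N * l := by nlinarith
    exact_mod_cast this
  have hY : JoinedIn S (p + (0, ((-(N * l) : ℤ) : ℝ))) (p + (0, ((N * l : ℤ) : ℝ))) := by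
    refine JoinedIn.trans ?_ (hSN N)
    convert joinedIn_translate (hSN N) (v := (0, ((-(N * l) : ℤ) : ℝ)))
        (fun z hz => verticalSaturation_add hz _) using 1
    ext <;> simp
  have hSR : ∀ z ∈ S, |z.1| ≤ R := by
    rintro z ⟨k, hk⟩
    simpa using hR _ hk
  have hp := abs_le.1 (le_refl |p.2|)
  obtain ⟨w, ⟨t, rfl⟩, hw⟩ := joinedIn_cross (X := range a) ⟨a, fun t => mem_range_self t⟩ hY h₀ h₁
    (fun z hz => (abs_le.1 (hSR z hz)).1) (fun z hz => (abs_le.1 (hSR z hz)).2)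
    (by
      rintro _ ⟨t, rfl⟩ - -
      have := abs_le.1 (hM t)
      simp only [Prod.snd_add, Int.cast_neg]
      linarith)
    (by
      rintro _ ⟨t, rfl⟩ - -
      have := abs_le.1 (hM t)
      simp only [Prod.snd_add]
      linarith)
  exact ⟨a t, hX.somePath_mem t, hw⟩

variable {Φ : (ℝ × ℝ) ≃ₜ (ℝ × ℝ)} {α C : ℝ}

/-- The level of a point with respect to the increasing family `leftSet`. -/
noncomputable def level (Φ : (ℝ × ℝ) ≃ₜ (ℝ × ℝ)) (α C : ℝ) (z : ℝ × ℝ) : ℝ :=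
  sInf {s | z ∈ leftSet Φ α C s}

theorem level_lt_iff (hb : HasHorizontalBound Φ α C) (z : ℝ × ℝ) (s : ℝ) :
    level Φ α C z < s ↔ ∃ s' < s, z ∈ leftSet Φ α C s' := by
  have hbdd : BddBelow {s | z ∈ leftSet Φ α C s} := ⟨z.1, fun s hs => le_of_mem_leftSet hs⟩
  have hne : {s | z ∈ leftSet Φ α C s}.Nonempty :=
    ⟨z.1 + C + 1, mem_leftSet_of_lt hb (by linarith)⟩
  rw [level, csInf_lt_iff hbdd hne]
  exact ⟨fun ⟨b, h, h'⟩ => ⟨b, h', h⟩, fun ⟨b, h', h⟩ => ⟨b, h, h'⟩⟩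

theorem IsShift.level_eq (hb : HasHorizontalBound Φ α C) {Ψ : (ℝ × ℝ) ≃ₜ (ℝ × ℝ)} {t : ℝ}
    (h : IsShift Φ α Ψ t) (z : ℝ × ℝ) : level Φ α C (Ψ z) = level Φ α C z + t := by
  refine eq_of_forall_le_iff fun s => ?_
  rw [← not_lt, ← not_lt, not_iff_not, ← lt_sub_iff_add_lt, level_lt_iff hb, level_lt_iff hb]
  constructor
  · rintro ⟨s', hs, hz⟩
    exact ⟨s' - t, by linarith, (h.mem_leftSet_iff hb _ z).2 (by simpa using hz)⟩
  · rintro ⟨s', hs, hz⟩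
    exact ⟨s' + t, by linarith, (h.mem_leftSet_iff hb _ z).1 hz⟩

/-- If every strip contains a vertically essential curve, no point separates levels. -/
theorem notMem_closure_leftSet (hb : HasHorizontalBound Φ α C)
    (hess : ∀ r s, r < s → ∃ (p : ℝ × ℝ) (l : ℤ), l ≠ 0 ∧
      JoinedIn (strip Φ α C r s) p (p + (0, (l : ℝ))))
    {c d : ℤ} (hΦ : ActsOnLattice Φ c d) (hd : d * d = 1)
    {r t : ℝ} (hrt : r < t) {z : ℝ × ℝ} (hz : z ∉ leftSet Φ α C t) :
    z ∉ closure (leftSet Φ α C r) := by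
  intro hcl
  obtain ⟨s, hrs, hst⟩ := exists_between hrt
  obtain ⟨p, l, hl, hj⟩ := hess r s hrs
  set K := range hj.somePath
  have hKc : IsCompact K := isCompact_range hj.somePath.continuous
  have hKj : JoinedIn K p (p + (0, (l : ℝ))) := ⟨hj.somePath, fun t => mem_range_self t⟩
  have hsat : verticalSaturation K ⊆ strip Φ α C r s := by
    rintro w ⟨k, u, hu⟩
    have := (isShift_translation (α := α) hΦ hd 0 k).mem_strip_iff hb r s w
    simp only [Homeomorph.coe_addRight, Int.cast_zero, add_zero] at this
    rw [this, ← hu]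
    exact hj.somePath_mem u
  obtain ⟨R, hR⟩ : ∃ R, ∀ w ∈ K, |w.1| ≤ R := by
    obtain ⟨R, hR⟩ := (hKc.image (f := fun w : ℝ × ℝ => |w.1|) (by fun_prop)).bddAbove
    exact ⟨R, fun w hw => hR ⟨w, hw, rfl⟩⟩
  have hzS : z ∈ (verticalSaturation K)ᶜ := fun h => hz (leftSet_mono hb hst.le (hsat h).1)
  obtain ⟨ε, hε, hball⟩ := Metric.isOpen_iff.1 (isClosed_verticalSaturation hKc).isOpen_compl z hzS
  have hpre : IsPathConnected (Metric.ball z ε) :=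
    (convex_ball z ε).isPathConnected ⟨z, Metric.mem_ball_self hε⟩
  obtain ⟨u, huB, huL⟩ := mem_closure_iff.1 hcl _ Metric.isOpen_ball (Metric.mem_ball_self hε)
  -- The ball meets `leftSet` at level `t` but is not contained in it, so it meets the frontier,
  -- which lies in the closure of `rightSet`.
  obtain ⟨w, hwB, hwW⟩ : (Metric.ball z ε ∩ rightSet Φ α t).Nonempty := by
    have hfr : (Metric.ball z ε ∩ frontier (leftSet Φ α C t)).Nonempty := by
      by_contra hne
      have hcov : Metric.ball z ε ⊆ leftSet Φ α C t ∪ (closure (leftSet Φ α C t))ᶜ := by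
        intro v hv
        by_contra hv'
        rw [mem_union, not_or, mem_compl_iff, not_not] at hv'
        exact hne ⟨v, hv, (isOpen_leftSet t).frontier_eq ▸ ⟨hv'.2, hv'.1⟩⟩
      have hzB := Metric.mem_ball_self (x := z) hε
      obtain ⟨v, -, hv, hv'⟩ := hpre.isConnected.isPreconnected _ _ (isOpen_leftSet t)
        isClosed_closure.isOpen_compl hcov ⟨u, huB, leftSet_mono hb hrt.le huL⟩
        ⟨z, hzB, (hcov hzB).resolve_left hz⟩
      exact hv' (subset_closure hv)
    obtain ⟨v, hvB, hv⟩ := hfr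
    exact mem_closure_iff.1 (frontier_leftSet_subset hv) _ Metric.isOpen_ball hvB
  -- The ball bridges the two regions, so `X` leads from far left to far right. No part of `X` can
  -- meet the saturated curve, which lies in the strip between `r` and `s < t`.
  set X := leftSet Φ α C r ∪ (Metric.ball z ε ∪ rightSet Φ α t)
  set a₀ : ℝ × ℝ := (min (r - C) (-R) - 1, 0)
  set a₁ : ℝ × ℝ := (max t R + 1, 0)
  have h₀ : a₀ ∈ leftSet Φ α C r := mem_leftSet_of_lt hb (by
    have := min_le_left (r - C) (-R)
    simp only [a₀]; linarith)
  have h₁ : a₁ ∈ rightSet Φ α t := mem_rightSet_of_lt (by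
    have := le_max_left t R
    simp only [a₁]; linarith)
  have hX : JoinedIn X a₀ a₁ :=
    ((((isPathConnected_leftSet hb r).joinedIn _ h₀ _ huL).mono subset_union_left).trans
      ((hpre.joinedIn _ huB _ hwB).mono
        (subset_union_left.trans subset_union_right))).trans
      (((isPathConnected_rightSet hb t).joinedIn _ hwW _ h₁).mono
        (subset_union_right.trans subset_union_right))
  obtain ⟨v, hvX, hvS⟩ := periodic_cross hl hKj hR hX
    (by have := min_le_right (r - C) (-R); simp only [a₀]; linarith)
    (by have := le_max_right t R; simp only [a₁]; linarith)
  rcases hvX with hv | hv | hv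
  · exact notMem_rightSet_of_mem_leftSet hv (hsat hvS).2
  · exact hball hv hvS
  · exact absurd (lt_of_mem_left_right (hsat hvS).1 hv) (not_lt.2 hst.le)

/-- Openness of `leftSet` gives upper semicontinuity; lower semicontinuity is
`notMem_closure_leftSet`. -/
theorem continuous_level (hb : HasHorizontalBound Φ α C)
    (hess : ∀ r s, r < s → ∃ (p : ℝ × ℝ) (l : ℤ), l ≠ 0 ∧
      JoinedIn (strip Φ α C r s) p (p + (0, (l : ℝ))))
    {c d : ℤ} (hΦ : ActsOnLattice Φ c d) (hd : d * d = 1) : Continuous (level Φ α C) := by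
  rw [continuous_iff_continuousAt]
  intro z
  refine tendsto_order.2 ⟨fun r hr => ?_, fun s hs => ?_⟩
  · obtain ⟨r₁, h1, h1'⟩ := exists_between hr
    obtain ⟨r₂, h2, h2'⟩ := exists_between h1'
    have hz : z ∉ leftSet Φ α C r₂ := fun h => by
      have hbdd : BddBelow {s | z ∈ leftSet Φ α C s} := ⟨z.1, fun s hs => le_of_mem_leftSet hs⟩
      exact absurd (csInf_le hbdd h) (not_le.2 h2')
    have := notMem_closure_leftSet hb hess hΦ hd h2 hz
    filter_upwards [isClosed_closure.isOpen_compl.mem_nhds this] with w hw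
    by_contra hle
    obtain ⟨s', hs', hw'⟩ := (level_lt_iff hb w r₁).1 (lt_of_le_of_lt (not_lt.1 hle) h1)
    exact hw (subset_closure (leftSet_mono hb hs'.le hw'))
  · obtain ⟨s', hs', hz⟩ := (level_lt_iff hb z s).1 hs
    filter_upwards [(isOpen_leftSet s').mem_nhds hz] with w hw
    exact (level_lt_iff hb w s).2 ⟨s', hs', hw⟩

end TorusRotationFactor

/-! ### Chains: crossings with translates, and vanishing of the twist. -/

namespace TorusRotationFactor

/-- A compact path connected set `K` in a thin strip that meets its image under `g`, in a
situation where slightly thicker strips contain no vertically essential curve. -/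
structure IsChain (Φ : (ℝ × ℝ) ≃ₜ (ℝ × ℝ)) (α C : ℝ) (g : (ℝ × ℝ) ≃ₜ (ℝ × ℝ)) (η e : ℝ)
    (c : ℤ) (K : Set (ℝ × ℝ)) : Prop where
  bound : HasHorizontalBound Φ α C
  translation : ∀ m k : ℤ, IsShift Φ α (Homeomorph.addRight ((m : ℝ), (k : ℝ))) m
  lattice : ActsOnLattice g c 1
  shift : IsShift Φ α g η
  shift_ne : η ≠ 0
  shift_le : |η| ≤ e
  compact : IsCompact K
  pathConnected : IsPathConnected K
  meets : (K ∩ g '' K).Nonempty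
  subset : K ⊆ strip Φ α C (-e) e
  no_loop : ∀ (r : ℝ) (p : ℝ × ℝ) (l : ℤ), l ≠ 0 →
    ¬ JoinedIn (strip Φ α C (r - 4 * e) (r + 4 * e)) p (p + (0, (l : ℝ)))

/-- The image of `K` under the `j`-th iterate of `g`. -/
def piece (g : (ℝ × ℝ) ≃ₜ (ℝ × ℝ)) (K : Set (ℝ × ℝ)) (j : ℤ) : Set (ℝ × ℝ) := (g ^ j) '' K

/-- The union of all images of `K` under iterates of `g`. -/
def orbitSet (g : (ℝ × ℝ) ≃ₜ (ℝ × ℝ)) (K : Set (ℝ × ℝ)) : Set (ℝ × ℝ) := ⋃ j, piece g K j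

theorem mem_orbitSet {g : (ℝ × ℝ) ≃ₜ (ℝ × ℝ)} {K : Set (ℝ × ℝ)} {z : ℝ × ℝ} :
    z ∈ orbitSet g K ↔ ∃ j, z ∈ piece g K j := mem_iUnion

theorem zpow_mem_piece_iff {g : (ℝ × ℝ) ≃ₜ (ℝ × ℝ)} {K : Set (ℝ × ℝ)} {z : ℝ × ℝ} (i j : ℤ) :
    (g ^ i) z ∈ piece g K (i + j) ↔ z ∈ piece g K j := by
  have : piece g K (i + j) = (g ^ i) '' piece g K j := by
    rw [piece, piece, zpow_add, ← image_comp]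
    rfl
  rw [this, (g ^ i).injective.mem_set_image]

theorem zpow_mem_orbitSet_iff {g : (ℝ × ℝ) ≃ₜ (ℝ × ℝ)} {K : Set (ℝ × ℝ)} {z : ℝ × ℝ} (i : ℤ) :
    (g ^ i) z ∈ orbitSet g K ↔ z ∈ orbitSet g K := by
  rw [mem_orbitSet, mem_orbitSet]
  constructor
  · rintro ⟨j, hj⟩
    exact ⟨j - i, (zpow_mem_piece_iff i _).1 (by simpa using hj)⟩
  · rintro ⟨j, hj⟩
    exact ⟨i + j, (zpow_mem_piece_iff i j).2 hj⟩

/-- A number between two others is as close to a given point as the farther one. -/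
theorem abs_int_mul_sub_le {i j k : ℤ} {η M B : ℝ} (hk : k ∈ uIcc i j) (hi : |i * η - M| ≤ B)
    (hj : |j * η - M| ≤ B) : |k * η - M| ≤ B := by
  have hk' : (k : ℝ) * η ∈ uIcc ((i : ℝ) * η) (j * η) := by
    rw [mem_uIcc] at hk ⊢
    rcases le_total 0 η with h | h
    · refine hk.imp (fun hh => ⟨?_, ?_⟩) (fun hh => ⟨?_, ?_⟩) <;>
        exact mul_le_mul_of_nonneg_right (by exact_mod_cast (by omega)) h
    · refine hk.symm.imp (fun hh => ⟨?_, ?_⟩) (fun hh => ⟨?_, ?_⟩) <;>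
        exact mul_le_mul_of_nonpos_right (by exact_mod_cast (by omega)) h
  have hs : uIcc ((i : ℝ) * η) (j * η) ⊆ Icc (M - B) (M + B) := by
    rw [abs_le] at hi hj
    exact uIcc_subset_Icc ⟨by linarith, by linarith⟩ ⟨by linarith, by linarith⟩
  have := hs hk'
  rw [abs_le]
  exact ⟨by linarith [this.1], by linarith [this.2]⟩

theorem exists_int_mul_gt {η : ℝ} (hη : η ≠ 0) (A : ℝ) : ∃ j : ℤ, A < j * η := by
  rcases hη.lt_or_gt with h | h
  · obtain ⟨n, hn⟩ := exists_nat_gt (A / -η)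
    refine ⟨-n, ?_⟩
    rw [div_lt_iff₀ (by linarith)] at hn
    push_cast
    linarith
  · obtain ⟨n, hn⟩ := exists_nat_gt (A / η)
    refine ⟨n, ?_⟩
    rw [div_lt_iff₀ h] at hn
    exact_mod_cast hn

namespace IsChain

variable {Φ : (ℝ × ℝ) ≃ₜ (ℝ × ℝ)} {α C : ℝ} {g : (ℝ × ℝ) ≃ₜ (ℝ × ℝ)} {η e : ℝ} {c : ℤ}
  {K : Set (ℝ × ℝ)}

theorem piece_subset (h : IsChain Φ α C g η e c K) {j : ℤ} {z : ℝ × ℝ} (hz : z ∈ piece g K j) :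
    z ∈ strip Φ α C (j * η - e) (j * η + e) := by
  obtain ⟨w, hw, rfl⟩ := hz
  have := ((h.shift.zpow j).mem_strip_iff h.bound _ _ w).1 (h.subset hw)
  convert this using 2 <;> ring

theorem abs_fst_le (h : IsChain Φ α C g η e c K) {j : ℤ} {z : ℝ × ℝ} (hz : z ∈ piece g K j) :
    |z.1 - j * η| ≤ e + C := by
  have hs := h.piece_subset hz
  have h1 := lt_of_mem_rightSet h.bound hs.2
  have h2 := le_of_mem_leftSet hs.1
  have := h.bound.nonneg
  rw [abs_le]
  exact ⟨by linarith, by linarith⟩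

/-- Consecutive pieces overlap because `K` meets `g '' K`. Recording the indices used keeps track of
the levels visited. -/
theorem joined_of_le (h : IsChain Φ α C g η e c K) {i j : ℤ} (hij : i ≤ j) {x : ℝ × ℝ}
    (hx : x ∈ piece g K i) : ∀ y ∈ piece g K j,
    JoinedIn {z | ∃ k, i ≤ k ∧ k ≤ j ∧ z ∈ piece g K k} x y := by
  have hpc : ∀ k, IsPathConnected (piece g K k) := fun k =>
    h.pathConnected.image (g ^ k).continuous
  induction j, hij using Int.leInduction with
  | base =>
    exact fun y hy => ((hpc i).joinedIn x hx y hy).mono fun z hz => ⟨i, le_rfl, le_rfl, hz⟩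
  | succ j hij ih =>
    intro y hy
    obtain ⟨w, hw, u, hu, huw⟩ := h.meets
    have hw1 : (g ^ j) w ∈ piece g K j := mem_image_of_mem _ hw
    have hw2 : (g ^ j) w ∈ piece g K (j + 1) :=
      ⟨u, hu, by rw [zpow_add_one, Homeomorph.mul_apply, huw]⟩
    refine JoinedIn.trans ((ih _ hw1).mono ?_) (((hpc (j + 1)).joinedIn _ hw2 y hy).mono ?_)
    · exact fun z ⟨k, h1, h2, h3⟩ => ⟨k, h1, by omega, h3⟩
    · exact fun z hz => ⟨j + 1, by omega, le_rfl, hz⟩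

theorem joined (h : IsChain Φ α C g η e c K) {i j : ℤ} {x y : ℝ × ℝ}
    (hx : x ∈ piece g K i) (hy : y ∈ piece g K j) :
    JoinedIn {z | ∃ k ∈ uIcc i j, z ∈ piece g K k} x y := by
  rcases le_total i j with hij | hij
  · refine (h.joined_of_le hij hx y hy).mono fun z ⟨k, h1, h2, h3⟩ => ⟨k, ?_, h3⟩
    rw [uIcc_of_le hij]; exact ⟨h1, h2⟩
  · refine (h.joined_of_le hij hy x hx).symm.mono fun z ⟨k, h1, h2, h3⟩ => ⟨k, ?_, h3⟩
    rw [uIcc_of_ge hij]; exact ⟨h1, h2⟩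

/-- The orbit of `K` is bounded vertically over bounded intervals. -/
theorem exists_window_bound (h : IsChain Φ α C g η e c K) (R : ℝ) :
    ∃ b, 0 ≤ b ∧ ∀ z ∈ orbitSet g K, |z.1| ≤ R → |z.2| ≤ b := by
  have hη : 0 < |η| := abs_pos.2 h.shift_ne
  -- The piece of index `j` stays within `e + C` of `j * η` horizontally, so only indices with `|j|
  -- < N` reach the window.
  obtain ⟨N, hN⟩ := exists_nat_gt ((R + (e + C)) / |η|)
  rw [div_lt_iff₀ hη] at hN
  have hc : IsCompact (⋃ j ∈ Icc (-(N : ℤ)) N, piece g K j) :=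
    (finite_Icc _ _).isCompact_biUnion fun j _ => h.compact.image (g ^ j).continuous
  obtain ⟨b, hb⟩ := (hc.image (f := fun w : ℝ × ℝ => |w.2|) (by fun_prop)).bddAbove
  refine ⟨max b 0, le_max_right _ _, fun z hz hzR => le_max_of_le_left (hb ⟨z, ?_, rfl⟩)⟩
  obtain ⟨j, hj⟩ := mem_orbitSet.1 hz
  refine mem_biUnion (x := j) ?_ hj
  have h1 := h.abs_fst_le hj
  have h2 : |(j : ℝ)| * |η| < N * |η| := by
    rw [← abs_mul]
    have : |(j : ℝ) * η| ≤ |z.1| + |z.1 - j * η| := by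
      have := abs_sub z.1 (z.1 - j * η)
      simpa using this
    linarith
  have h3 := lt_of_mul_lt_mul_right h2 hη.le
  have h4 : |j| < (N : ℤ) := by exact_mod_cast h3
  exact ⟨by linarith [(abs_lt.1 h4).1], (abs_lt.1 h4).2.le⟩

/-- No path avoiding a translate of the orbit of `K` leads from below to above. -/
theorem separates (h : IsChain Φ α C g η e c K) {Y : Set (ℝ × ℝ)} {u w q : ℝ × ℝ} {l r : ℝ}
    (hY : JoinedIn Y u w) (hYl : ∀ z ∈ Y, l ≤ z.1) (hYr : ∀ z ∈ Y, z.1 ≤ r)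
    (hdis : ∀ z ∈ Y, z - q ∉ orbitSet g K)
    (hu : ∀ z, z - q ∈ orbitSet g K → l ≤ z.1 → z.1 ≤ r → u.2 < z.2)
    (hw : ∀ z, z - q ∈ orbitSet g K → l ≤ z.1 → z.1 ≤ r → z.2 < w.2) : False := by
  -- Since `η ≠ 0`, some piece lies entirely left of the band and another entirely right of it; the
  -- chain between them is the barrier.
  obtain ⟨i, hi⟩ := exists_int_mul_gt (neg_ne_zero.2 h.shift_ne) (-(l - q.1 - (e + C)))
  obtain ⟨j, hj⟩ := exists_int_mul_gt h.shift_ne (r - q.1 + (e + C))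
  obtain ⟨p, hp⟩ := h.pathConnected.nonempty
  have pi : (g ^ i) p ∈ piece g K i := mem_image_of_mem _ hp
  have pj : (g ^ j) p ∈ piece g K j := mem_image_of_mem _ hp
  have hX : JoinedIn {z | z - q ∈ orbitSet g K} ((g ^ i) p + q) ((g ^ j) p + q) :=
    joinedIn_translate (h.joined pi pj) fun z ⟨k, _, hk⟩ => by
      have : z + q - q ∈ orbitSet g K := by rw [add_sub_cancel_right]; exact mem_orbitSet.2 ⟨k, hk⟩
      exact this
  have bi := abs_le.1 (h.abs_fst_le pi)
  have bj := abs_le.1 (h.abs_fst_le pj)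
  obtain ⟨z, hz1, hz2⟩ := joinedIn_cross hX hY
    (by simp only [Prod.fst_add]; linarith) (by simp only [Prod.fst_add]; linarith) hYl hYr hu hw
  exact hdis z hz2 hz1

/-- Accounts for the `4 * e` in `no_loop`: the centre of the piece may be off by `3 * e`, and its
half-width is `e`. -/
theorem mem_strip_of_mem_piece (h : IsChain Φ α C g η e c K) {j : ℤ} {z : ℝ × ℝ} {M : ℝ}
    (hz : z ∈ piece g K j) (hj : |j * η - M| ≤ 3 * e) :
    z ∈ strip Φ α C (M - 4 * e) (M + 4 * e) := by
  rw [abs_le] at hj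
  exact strip_mono h.bound (by linarith) (by linarith) (h.piece_subset hz)

theorem add_mem_strip (h : IsChain Φ α C g η e c K) {z : ℝ × ℝ} {r s : ℝ}
    (hz : z ∈ strip Φ α C r s) (m k : ℤ) :
    z + ((m : ℝ), (k : ℝ)) ∈ strip Φ α C (r + m) (s + m) :=
  ((h.translation m k).mem_strip_iff h.bound r s z).1 hz

/-- Crossings at nearby levels of the orbit of `K` with its translates in a fixed column
happen at one height only. -/
theorem crossing_unique (h : IsChain Φ α C g η e c K) {i i' j j' m k k' : ℤ} {x y : ℝ × ℝ}
    (hx : x + ((m : ℝ), (k : ℝ)) ∈ piece g K i) (hx' : x ∈ piece g K i')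
    (hy : y + ((m : ℝ), (k' : ℝ)) ∈ piece g K j) (hy' : y ∈ piece g K j')
    (hij : |i' * η - j' * η| ≤ e) : k = k' := by
  by_contra hne
  have he : 0 ≤ e := (abs_nonneg _).trans h.shift_le
  have near : ∀ {i i' k : ℤ} {x : ℝ × ℝ}, x + ((m : ℝ), (k : ℝ)) ∈ piece g K i →
      x ∈ piece g K i' → |i * η - (i' * η + m)| ≤ 2 * e := by
    intro i i' k x hx hx'
    have s1 := h.piece_subset hx
    have s2 := h.add_mem_strip (h.piece_subset hx') m k
    have a1 := lt_of_mem_left_right s1.1 s2.2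
    have a2 := lt_of_mem_left_right s2.1 s1.2
    rw [abs_le]
    exact ⟨by linarith, by linarith⟩
  have n1 := abs_le.1 (near hx hx')
  have n2 := abs_le.1 (near hy hy')
  have hij' := abs_le.1 hij
  set M : ℝ := i' * η + m
  -- Go from the first crossing to the second along the orbit, then back along its translate by `(m,
  -- k')`. The result ends at the starting point raised by `k' - k`.
  have path1 : JoinedIn (strip Φ α C (M - 4 * e) (M + 4 * e)) (x + ((m : ℝ), (k : ℝ)))
      (y + ((m : ℝ), (k' : ℝ))) := by
    refine (h.joined hx hy).mono fun z ⟨u, hu, hz⟩ => h.mem_strip_of_mem_piece hz ?_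
    exact abs_int_mul_sub_le hu (abs_le.2 ⟨by linarith, by linarith⟩)
      (abs_le.2 ⟨by linarith, by linarith⟩)
  have path2 : JoinedIn (strip Φ α C (M - 4 * e) (M + 4 * e)) (y + ((m : ℝ), (k' : ℝ)))
      (x + ((m : ℝ), (k' : ℝ))) := by
    refine joinedIn_translate (h.joined hy' hx') fun z ⟨u, hu, hz⟩ => ?_
    have hb : |u * η - i' * η| ≤ 3 * e :=
      abs_int_mul_sub_le hu (abs_le.2 ⟨by linarith, by linarith⟩) (by simpa using he)
    convert h.add_mem_strip (h.mem_strip_of_mem_piece hz hb) m k' using 2 <;>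
      simp only [M] <;> ring
  refine h.no_loop M (x + ((m : ℝ), (k : ℝ))) (k' - k) (by omega) ?_
  convert path1.trans path2 using 1
  ext <;> simp

/-- The lattice action of `g` is trivial. -/
theorem twist_eq_zero (h : IsChain Φ α C g η e c K) : c = 0 := by
  by_contra hc
  -- Applying `g` to a crossing in column `1` at height `k` gives one at height `k + c`, at a level
  -- only `|η| ≤ e` away. Uniqueness forbids this when `c ≠ 0`.
  have noCross : ∀ (k : ℤ) (z : ℝ × ℝ), z ∈ orbitSet g K →
      z + (1, (k : ℝ)) ∉ orbitSet g K := by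
    intro k z hz hz'
    obtain ⟨i', hi'⟩ := mem_orbitSet.1 hz
    obtain ⟨i, hi⟩ := mem_orbitSet.1 hz'
    have e1 : g (z + (1, (k : ℝ))) = g z + (1, ((k + c : ℤ) : ℝ)) := by
      have := h.lattice z 1 k
      simp only [Int.cast_one] at this
      rw [this]
      congr 3
      ring
    have hi2 : g (z + (1, (k : ℝ))) ∈ piece g K (1 + i) := by
      have := (zpow_mem_piece_iff (g := g) 1 i).2 hi
      simpa using this
    have hi2' : g z ∈ piece g K (1 + i') := by
      have := (zpow_mem_piece_iff (g := g) 1 i').2 hi'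
      simpa using this
    rw [e1] at hi2
    have := h.crossing_unique (m := 1) (k := k) (k' := k + c) (by simpa using hi) hi'
      (by simpa using hi2) hi2' (by
        have := h.shift_le
        push_cast
        rw [show (i' : ℝ) * η - (1 + i') * η = -η by ring, abs_neg]
        exact this)
    omega
  obtain ⟨p, hp⟩ := h.pathConnected.nonempty
  obtain ⟨b, -, hb⟩ := h.exists_window_bound |p.1 + 1|
  obtain ⟨N, hN⟩ := exists_nat_gt (b + |p.2|)
  have hp2 := abs_le.1 (le_refl |p.2|)
  -- Under `g ^ i` the twist lowers column `1` by `2 * N * c ^ 2`, at least `2 * N`; points above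
  -- the orbit are thereby brought to the translate passing below.
  set i : ℤ := -c * (2 * N)
  have hci : (N : ℤ) ≤ -N - i * c := by
    have : 1 ≤ c * c := by nlinarith [mul_self_pos.2 hc]
    simp only [i]
    nlinarith [Int.natCast_nonneg N]
  obtain ⟨R, hR⟩ : ∃ R : ℝ, R = |p.1 + 1| + |i * η| + e + C + 1 := ⟨_, rfl⟩
  obtain ⟨b', hb'0, hb'⟩ := h.exists_window_bound R
  have he : 0 ≤ e := (abs_nonneg _).trans h.shift_le
  have hC := h.bound.nonneg
  obtain ⟨A, hA⟩ := exists_nat_gt (N + b' + |p.2|)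
  have hact : ∀ k : ℤ, (g ^ i) (p + (1, (k : ℝ))) = (g ^ i) p + (1, ((i * c + k : ℤ) : ℝ)) := by
    intro k
    have := h.lattice.zpow_one i p 1 k
    simpa using this
  obtain ⟨B, hB⟩ := exists_nat_gt (max (N : ℝ) (b' - ((g ^ i) p).2 - i * c))
  -- A path from below the orbit to above it that never meets it: up a vertical ray below the orbit,
  -- along a translate of the orbit (`noCross`), then along the `g ^ i`-image of a ray above the
  -- orbit, which is disjoint from it by invariance.
  let Y₁ : Set (ℝ × ℝ) := {z | z.1 = p.1 + 1 ∧ z.2 ≤ p.2 - N}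
  let Y₂ : Set (ℝ × ℝ) := {z | ∃ k ∈ uIcc 0 i, z + (-1, (N : ℝ)) ∈ piece g K k}
  let Y₃ : Set (ℝ × ℝ) := (g ^ i) '' {z | z.1 = p.1 + 1 ∧ p.2 + N ≤ z.2}
  let Y := Y₁ ∪ (Y₂ ∪ Y₃)
  have j1 : JoinedIn Y (p.1 + 1, p.2 - A) (p.1 + 1, p.2 - N) := by
    refine joinedIn_vertical fun t ht => Or.inl ⟨rfl, ?_⟩
    have := abs_nonneg p.2
    rw [uIcc_of_le (by linarith)] at ht
    exact ht.2
  have j2 : JoinedIn Y (p.1 + 1, p.2 - N) ((g ^ i) p + (1, -(N : ℝ))) := by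
    have h0 : p ∈ piece g K 0 := ⟨p, hp, by simp⟩
    have hi : (g ^ i) p ∈ piece g K i := mem_image_of_mem _ hp
    have := joinedIn_translate (v := (1, -(N : ℝ))) (S' := Y) (h.joined h0 hi)
      fun z ⟨k, hk, hz⟩ => Or.inr (Or.inl ⟨k, hk, by
        convert hz using 1
        ext <;> simp⟩)
    convert this using 1
    ext <;> simp [sub_eq_add_neg]
  have j3 : JoinedIn Y ((g ^ i) p + (1, -(N : ℝ))) ((g ^ i) (p + (1, ((B : ℤ) : ℝ)))) := by
    have hk := hact (-N - i * c)
    rw [show i * c + (-N - i * c) = -(N : ℤ) by ring] at hk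
    have hk' : (g ^ i) p + (1, -(N : ℝ)) = (g ^ i) (p + (1, ((-N - i * c : ℤ) : ℝ))) := by
      rw [hk]; push_cast; rfl
    rw [hk']
    have hv : JoinedIn {z : ℝ × ℝ | z.1 = p.1 + 1 ∧ p.2 + N ≤ z.2}
        (p.1 + 1, p.2 + ((-N - i * c : ℤ) : ℝ)) (p.1 + 1, p.2 + ((B : ℤ) : ℝ)) := by
      refine joinedIn_vertical fun t ht => ⟨rfl, ?_⟩
      have h1 : (N : ℝ) ≤ ((-N - i * c : ℤ) : ℝ) := by exact_mod_cast hci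
      have h2 : (N : ℝ) ≤ ((B : ℤ) : ℝ) := by
        have := (le_max_left _ _).trans hB.le
        exact_mod_cast this
      rcases mem_uIcc.1 ht with ht | ht <;> simp only <;> linarith [ht.1]
    have := (hv.map (f := g ^ i) (g ^ i).continuous).mono (V := Y)
      (subset_union_right.trans subset_union_right)
    exact this
  have hYx : ∀ z ∈ Y, |z.1| ≤ R := by
    have hpx := abs_le.1 (le_refl |p.1 + 1|)
    have hix := abs_le.1 (le_refl |(i : ℝ) * η|)
    rintro z (⟨hz, -⟩ | ⟨k, hk, hz⟩ | ⟨w, ⟨hw, -⟩, rfl⟩)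
    · rw [hz, hR]
      have := abs_nonneg ((i : ℝ) * η)
      linarith
    · have h1 := abs_le.1 (h.abs_fst_le hz)
      have h2 := abs_le.1 (abs_int_mul_sub_le (η := η) (M := 0) (B := |(i : ℝ) * η|) hk
        (by simpa using abs_nonneg ((i : ℝ) * η)) (by simp))
      simp only [Prod.fst_add] at h1
      rw [abs_le]
      have := abs_nonneg (p.1 + 1)
      constructor <;> linarith
    · have h1 := abs_le.1 ((h.shift.zpow i).abs_le h.bound w)
      rw [abs_le]
      constructor <;> linarith
  refine h.separates (q := 0) ((j1.trans j2).trans j3) (fun z hz => (abs_le.1 (hYx z hz)).1)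
    (fun z hz => (abs_le.1 (hYx z hz)).2) ?_ ?_ ?_
  · have far : ∀ z : ℝ × ℝ, z.1 = p.1 + 1 → z ∈ orbitSet g K → |z.2| ≤ b :=
      fun z hz hz' => hb z hz' (by rw [hz])
    rintro z (⟨hz, hz2⟩ | ⟨k, hk, hz⟩ | ⟨w, ⟨hw, hw2⟩, rfl⟩) hzo
    · rw [sub_zero] at hzo
      have := abs_le.1 (far z hz hzo)
      linarith
    · refine noCross (-N) _ (mem_orbitSet.2 ⟨k, hz⟩) ?_
      convert hzo using 1
      ext <;> simp
    · rw [sub_zero, zpow_mem_orbitSet_iff] at hzo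
      have := abs_le.1 (far w hw hzo)
      linarith
  · intro z hz h1 h2
    rw [sub_zero] at hz
    have := abs_le.1 (hb' z hz (abs_le.2 ⟨h1, h2⟩))
    simp only
    have : (0 : ℝ) ≤ N := Nat.cast_nonneg N
    linarith
  · intro z hz h1 h2
    rw [sub_zero] at hz
    have := abs_le.1 (hb' z hz (abs_le.2 ⟨h1, h2⟩))
    have h3 := (le_max_right _ _).trans_lt hB
    rw [hact]
    simp only [Prod.snd_add]
    push_cast
    linarith

end IsChain

end TorusRotationFactor

/-! ### Chains without twist have bounded deviations. -/

namespace TorusRotationFactor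

/-- An additive sequence up to a bounded error is linear up to a bounded error. -/
theorem exists_linear_of_quasiadditive {s : ℕ → ℝ} {D : ℝ}
    (hs : ∀ i j, |s (i + j) - s i - s j| ≤ D) : ∃ ρ : ℝ, ∀ n, |s n - n * ρ| ≤ D := by
  have hD : 0 ≤ D := (abs_nonneg _).trans (hs 0 0)
  -- Fekete's lemma applies to both `s + D` and `-s + D`. The two limits are opposite, and each
  -- bounds its quotients from below, which gives the two inequalities.
  have hu : Subadditive fun n => s n + D := fun i j => by
    have := abs_le.1 (hs i j); simp only; linarith
  have hv : Subadditive fun n => -s n + D := fun i j => by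
    have := abs_le.1 (hs i j); simp only; linarith
  have hlin : ∀ n : ℕ, |s n| ≤ n * (|s 1| + D) + D := by
    intro n
    induction n with
    | zero =>
      have := hs 0 0
      simp only [add_zero, sub_self, zero_sub, abs_neg] at this
      simpa using this
    | succ n ih =>
      have h1 := abs_le.1 (hs n 1)
      have h2 := abs_le.1 (le_refl |s 1|)
      have h3 := abs_le.1 ih
      rw [abs_le]
      push_cast
      constructor <;> linarith
  have hb : ∀ {t : ℕ → ℝ}, (∀ n, |t n| = |s n|) → BddBelow (range fun n => (t n + D) / n) := by
    intro t ht
    refine ⟨-(|s 1| + D), ?_⟩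
    rintro _ ⟨n, rfl⟩
    have h1 := abs_nonneg (s 1)
    rcases Nat.eq_zero_or_pos n with rfl | hn
    · simp; linarith
    · have hn' : (0 : ℝ) < n := by exact_mod_cast hn
      simp only
      rw [le_div_iff₀ hn']
      have := (abs_le.1 ((ht n).trans_le (hlin n))).1
      linarith
  have t1 := hu.tendsto_lim (hb fun n => rfl)
  have t2 := hv.tendsto_lim (hb fun n => abs_neg _)
  have hsum : hu.lim + hv.lim = 0 := by
    refine tendsto_nhds_unique (t1.add t2) ?_
    have : Filter.Tendsto (fun n : ℕ => (2 * D) / (n : ℝ)) Filter.atTop (𝓝 0) :=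
      tendsto_const_div_atTop_nhds_zero_nat _
    refine this.congr fun n => ?_
    ring
  refine ⟨hu.lim, fun n => ?_⟩
  rcases Nat.eq_zero_or_pos n with rfl | hn
  · have := hlin 0
    simpa using this
  · have hn' : (0 : ℝ) < n := by exact_mod_cast hn
    have l1 := hu.lim_le_div (hb fun n => rfl) hn.ne'
    have l2 := hv.lim_le_div (hb fun n => abs_neg _) hn.ne'
    rw [le_div_iff₀ hn'] at l1 l2
    rw [abs_le]
    constructor <;> nlinarith

namespace IsChain

variable {Φ : (ℝ × ℝ) ≃ₜ (ℝ × ℝ)} {α C : ℝ} {g : (ℝ × ℝ) ≃ₜ (ℝ × ℝ)} {η e : ℝ}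
  {K : Set (ℝ × ℝ)}

theorem zpow_add (h : IsChain Φ α C g η e 0 K) (j m k : ℤ) (z : ℝ × ℝ) :
    (g ^ j) (z + ((m : ℝ), (k : ℝ))) = (g ^ j) z + ((m : ℝ), (k : ℝ)) := by
  have := h.lattice.zpow_one j z m k
  simpa using this

theorem zpow_vertical (h : IsChain Φ α C g η e 0 K) (j k : ℤ) (z : ℝ × ℝ) :
    (g ^ j) (z + (0, (k : ℝ))) = (g ^ j) z + (0, (k : ℝ)) := by
  have := h.zpow_add j 0 k z
  simpa only [Int.cast_zero] using this

/-- With no twist, `g ^ (i' - j')` moves the second crossing to the level of the first without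
changing its height, so the levels need not be close. -/
theorem crossing_unique_orbitSet (h : IsChain Φ α C g η e 0 K) {m k k' : ℤ} {x y : ℝ × ℝ}
    (hx : x + ((m : ℝ), (k : ℝ)) ∈ orbitSet g K) (hx' : x ∈ orbitSet g K)
    (hy : y + ((m : ℝ), (k' : ℝ)) ∈ orbitSet g K) (hy' : y ∈ orbitSet g K) : k = k' := by
  obtain ⟨i, hi⟩ := mem_orbitSet.1 hx
  obtain ⟨i', hi'⟩ := mem_orbitSet.1 hx'
  obtain ⟨j, hj⟩ := mem_orbitSet.1 hy
  obtain ⟨j', hj'⟩ := mem_orbitSet.1 hy'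
  have he : 0 ≤ e := (abs_nonneg _).trans h.shift_le
  have h1 := (zpow_mem_piece_iff (g := g) (i' - j') j).2 hj
  have h2 := (zpow_mem_piece_iff (g := g) (i' - j') j').2 hj'
  rw [h.zpow_add] at h1
  rw [sub_add_cancel] at h2
  exact h.crossing_unique hi hi' h1 h2 (by simpa using he)

/-- The orbit of `K` has uniformly bounded vertical oscillation over intervals of given
length. -/
theorem exists_oscillation_bound (h : IsChain Φ α C g η e 0 K) (R : ℝ) :
    ∃ D : ℝ, ∀ (j : ℤ), ∀ u ∈ orbitSet g K, ∀ v ∈ orbitSet g K, |u.1 - j * η| ≤ R →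
      |v.1 - j * η| ≤ R → u.2 - v.2 ≤ D := by
  -- One `e + C` bounds the centres of the pieces joining `v` to `u`, the other the distance to
  -- those centres, and `1` the rounding of `j * η` to `m`.
  set R₂ := R + 2 * (e + C) + 1
  obtain ⟨b, -, hb⟩ := h.exists_window_bound R₂
  refine ⟨2 * b + 2, fun j u hu v hv huR hvR => ?_⟩
  by_contra! hlt
  obtain ⟨i₁, hi₁⟩ := mem_orbitSet.1 hu
  obtain ⟨i₂, hi₂⟩ := mem_orbitSet.1 hv
  set m : ℤ := ⌊(j : ℝ) * η⌋
  have hm1 : (m : ℝ) ≤ j * η := Int.floor_le _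
  have hm2 : (j : ℝ) * η < m + 1 := Int.lt_floor_add_one _
  let Y : Set (ℝ × ℝ) := {z | ∃ k ∈ uIcc i₂ i₁, z + ((m : ℝ), 0) ∈ piece g K k}
  have hY : JoinedIn Y (v + (-(m : ℝ), 0)) (u + (-(m : ℝ), 0)) :=
    joinedIn_translate (h.joined hi₂ hi₁) fun z ⟨k, hk, hz⟩ => ⟨k, hk, by
      convert hz using 1
      ext <;> simp⟩
  have hYx : ∀ z ∈ Y, |z.1| ≤ R₂ := by
    rintro z ⟨k, hk, hz⟩
    have hu1 := abs_le.1 (h.abs_fst_le hi₁)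
    have hv1 := abs_le.1 (h.abs_fst_le hi₂)
    have hz1 := abs_le.1 (h.abs_fst_le hz)
    have hu2 := abs_le.1 huR
    have hv2 := abs_le.1 hvR
    have hk1 := abs_le.1 (abs_int_mul_sub_le (η := η) (M := j * η) (B := R + (e + C)) hk
      (abs_le.2 ⟨by linarith, by linarith⟩) (abs_le.2 ⟨by linarith, by linarith⟩))
    simp only [Prod.fst_add] at hz1
    rw [abs_le]
    simp only [R₂]
    constructor <;> linarith
  -- An oscillation above `2 * b + 2` leaves two integer heights at which the raised orbit passes
  -- between the ends of `Y`. Crossings in column `m` occur at one height only, so `Y` avoids one of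
  -- the two, against separation.
  obtain ⟨k, hk1, hk2, hkY⟩ : ∃ k : ℤ, v.2 + b < k ∧ (k : ℝ) + b < u.2 ∧
      ∀ z ∈ Y, z - (0, (k : ℝ)) ∉ orbitSet g K := by
    have f1 : v.2 + b < (⌊v.2 + b⌋ : ℝ) + 1 := Int.lt_floor_add_one _
    have f2 : (⌊v.2 + b⌋ : ℝ) ≤ v.2 + b := Int.floor_le _
    by_contra! hcon
    obtain ⟨z, hz, hz'⟩ := hcon (⌊v.2 + b⌋ + 1) (by push_cast; linarith) (by push_cast; linarith)
    obtain ⟨w, hw, hw'⟩ := hcon (⌊v.2 + b⌋ + 2) (by push_cast; linarith) (by push_cast; linarith)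
    obtain ⟨a, -, hza⟩ := hz
    obtain ⟨a', -, hwa⟩ := hw
    have := h.crossing_unique_orbitSet (m := m) (k := ⌊v.2 + b⌋ + 1) (k' := ⌊v.2 + b⌋ + 2)
      (x := z - (0, ((⌊v.2 + b⌋ + 1 : ℤ) : ℝ))) (y := w - (0, ((⌊v.2 + b⌋ + 2 : ℤ) : ℝ)))
      (mem_orbitSet.2 ⟨a, by convert hza using 1; ext <;> simp⟩) hz'
      (mem_orbitSet.2 ⟨a', by convert hwa using 1; ext <;> simp⟩) hw'
    omega
  refine h.separates hY (fun z hz => (abs_le.1 (hYx z hz)).1) (fun z hz => (abs_le.1 (hYx z hz)).2)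
    hkY ?_ ?_
  · intro z hz h1 h2
    have := abs_le.1 (hb _ hz (by simpa using abs_le.2 ⟨h1, h2⟩))
    simp only [Prod.snd_sub, Prod.snd_add] at this ⊢
    linarith
  · intro z hz h1 h2
    have := abs_le.1 (hb _ hz (by simpa using abs_le.2 ⟨h1, h2⟩))
    simp only [Prod.snd_sub, Prod.snd_add] at this ⊢
    linarith

/-- The iterates of points of the unit square stay close to the orbit of `K`. -/
theorem exists_shadow (h : IsChain Φ α C g η e 0 K) :
    ∃ L : ℝ, ∀ (j : ℤ) (z : ℝ × ℝ), z.1 ∈ Icc 0 1 → z.2 ∈ Icc 0 1 →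
      (∃ u ∈ orbitSet g K, |u.1 - j * η| ≤ C + 1 ∧ ((g ^ j) z).2 ≤ u.2 + L) ∧
      (∃ v ∈ orbitSet g K, |v.1 - j * η| ≤ C + 1 ∧ v.2 - L ≤ ((g ^ j) z).2) := by
  obtain ⟨b, -, hb⟩ := h.exists_window_bound 1
  obtain ⟨L, hL⟩ := exists_nat_gt (b + 1)
  refine ⟨L, fun j z hz1 hz2 => ?_⟩
  obtain ⟨b', -, hb'⟩ := h.exists_window_bound (|j * η| + (C + 1))
  obtain ⟨N, hN⟩ := exists_nat_gt (b' + L + |((g ^ j) z).2|)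
  have hgz := abs_le.1 (le_refl |((g ^ j) z).2|)
  have hfst : ∀ w : ℝ × ℝ, w.1 = z.1 →
      j * η - (C + 1) ≤ ((g ^ j) w).1 ∧ ((g ^ j) w).1 ≤ j * η + (C + 1) := by
    intro w hw
    have := abs_le.1 ((h.shift.zpow j).abs_le h.bound w)
    rw [hw] at this
    constructor <;> linarith [hz1.1, hz1.2]
  have hwin : ∀ w ∈ orbitSet g K, |w.1 - j * η| ≤ C + 1 → |w.2| ≤ b' := by
    intro w hw hw1
    refine hb' w hw ?_
    have := abs_add_le (w.1 - j * η) (j * η)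
    rw [sub_add_cancel] at this
    linarith
  have hnear : ∀ w : ℝ × ℝ, ∀ k : ℤ, w.1 = z.1 → (g ^ j) w - (0, (k : ℝ)) ∈ orbitSet g K →
      |w.2 - k| ≤ b := by
    intro w k hw hw'
    have e1 : (g ^ j) w - (0, (k : ℝ)) = (g ^ j) (w + (0, ((-k : ℤ) : ℝ))) := by
      rw [h.zpow_vertical]
      ext <;> simp [sub_eq_add_neg]
    rw [e1, zpow_mem_orbitSet_iff] at hw'
    have := hb _ hw' (by simpa [hw, abs_of_nonneg hz1.1] using hz1.2)
    simpa [sub_eq_add_neg] using this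
  constructor
  -- If the orbit near `j * η` were too low, the image of a vertical segment below `z` would pass
  -- from below to above the orbit raised by `L`. Pulled back by `g ^ j`, the segment would meet
  -- that raised orbit, which over the unit interval has height above `1`.
  · by_contra! hcon
    have hv : JoinedIn {w : ℝ × ℝ | w.1 = z.1 ∧ w.2 ≤ z.2} (z.1, z.2 + ((-N : ℤ) : ℝ))
        (z.1, z.2) := joinedIn_vertical fun t ht => ⟨rfl, by
      rw [uIcc_of_le (by push_cast; linarith [Nat.cast_nonneg (α := ℝ) N])] at ht
      exact ht.2⟩
    have hY := hv.map (f := g ^ j) (g ^ j).continuous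
    have e1 : (z.1, z.2 + ((-N : ℤ) : ℝ)) = z + (0, ((-N : ℤ) : ℝ)) := by ext <;> simp
    rw [e1, h.zpow_vertical] at hY
    refine h.separates (q := (0, ((L : ℤ) : ℝ))) (l := j * η - (C + 1)) (r := j * η + (C + 1)) hY
      ?_ ?_ ?_ ?_ ?_
    · rintro _ ⟨w, ⟨hw, -⟩, rfl⟩
      exact (hfst w hw).1
    · rintro _ ⟨w, ⟨hw, -⟩, rfl⟩
      exact (hfst w hw).2
    · rintro _ ⟨w, ⟨hw, hw2⟩, rfl⟩ hmem
      have := abs_le.1 (hnear w L hw hmem)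
      push_cast at this
      linarith [hz2.2]
    · intro w hw h1 h2
      have hx : |(w - (0, ((L : ℤ) : ℝ))).1 - j * η| ≤ C + 1 := by
        rw [abs_le]; simp only [Prod.fst_sub]; constructor <;> linarith
      have := abs_le.1 (hwin _ hw hx)
      simp only [Prod.snd_sub, Prod.snd_add] at this ⊢
      push_cast at this ⊢
      linarith
    · intro w hw h1 h2
      have hx : |(w - (0, ((L : ℤ) : ℝ))).1 - j * η| ≤ C + 1 := by
        rw [abs_le]; simp only [Prod.fst_sub]; constructor <;> linarith
      have := hcon _ hw hx
      simp only [Prod.snd_sub] at this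
      push_cast at this
      simpa using this
  · by_contra! hcon
    have hv : JoinedIn {w : ℝ × ℝ | w.1 = z.1 ∧ z.2 ≤ w.2} (z.1, z.2)
        (z.1, z.2 + ((N : ℤ) : ℝ)) := joinedIn_vertical fun t ht => ⟨rfl, by
      rw [uIcc_of_le (by push_cast; linarith [Nat.cast_nonneg (α := ℝ) N])] at ht
      exact ht.1⟩
    have hY := hv.map (f := g ^ j) (g ^ j).continuous
    have e1 : (z.1, z.2 + ((N : ℤ) : ℝ)) = z + (0, ((N : ℤ) : ℝ)) := by ext <;> simp
    rw [e1, h.zpow_vertical] at hY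
    refine h.separates (q := (0, ((-L : ℤ) : ℝ))) (l := j * η - (C + 1)) (r := j * η + (C + 1)) hY
      ?_ ?_ ?_ ?_ ?_
    · rintro _ ⟨w, ⟨hw, -⟩, rfl⟩
      exact (hfst w hw).1
    · rintro _ ⟨w, ⟨hw, -⟩, rfl⟩
      exact (hfst w hw).2
    · rintro _ ⟨w, ⟨hw, hw2⟩, rfl⟩ hmem
      have := abs_le.1 (hnear w (-L) hw hmem)
      push_cast at this
      linarith [hz2.1]
    · intro w hw h1 h2
      have hx : |(w - (0, ((-L : ℤ) : ℝ))).1 - j * η| ≤ C + 1 := by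
        rw [abs_le]; simp only [Prod.fst_sub]; constructor <;> linarith
      have := hcon _ hw hx
      simp only [Prod.snd_sub] at this
      push_cast at this
      linarith
    · intro w hw h1 h2
      have hx : |(w - (0, ((-L : ℤ) : ℝ))).1 - j * η| ≤ C + 1 := by
        rw [abs_le]; simp only [Prod.fst_sub]; constructor <;> linarith
      have := abs_le.1 (hwin _ hw hx)
      simp only [Prod.snd_sub, Prod.snd_add] at this ⊢
      push_cast at this ⊢
      linarith

/-- The vertical displacements of any two points differ by a uniformly bounded amount. -/
theorem exists_displacement_bound (h : IsChain Φ α C g η e 0 K) :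
    ∃ D : ℝ, ∀ (j : ℤ) (z w : ℝ × ℝ),
      |((g ^ j) z).2 - z.2 - (((g ^ j) w).2 - w.2)| ≤ D := by
  obtain ⟨L, hL⟩ := h.exists_shadow
  obtain ⟨D, hD⟩ := h.exists_oscillation_bound (C + 1)
  have key : ∀ (j : ℤ) (z w : ℝ × ℝ),
      ((g ^ j) z).2 - z.2 - (((g ^ j) w).2 - w.2) ≤ D + 2 * L + 1 := by
    intro j z w
    have red : ∀ z : ℝ × ℝ, ∃ z' : ℝ × ℝ, z'.1 ∈ Icc 0 1 ∧ z'.2 ∈ Icc 0 1 ∧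
        ((g ^ j) z).2 - z.2 = ((g ^ j) z').2 - z'.2 := by
      intro z
      refine ⟨(Int.fract z.1, Int.fract z.2), ⟨Int.fract_nonneg _, (Int.fract_lt_one _).le⟩,
        ⟨Int.fract_nonneg _, (Int.fract_lt_one _).le⟩, ?_⟩
      have hz : z = (Int.fract z.1, Int.fract z.2) + ((⌊z.1⌋ : ℝ), (⌊z.2⌋ : ℝ)) := by
        ext <;> simp
      have := congrArg Prod.snd (h.zpow_add j ⌊z.1⌋ ⌊z.2⌋ (Int.fract z.1, Int.fract z.2))
      rw [← hz] at this
      rw [this, Prod.snd_add]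
      simp only
      linarith [Int.fract_add_floor z.2]
    obtain ⟨z', hz1, hz2, ez⟩ := red z
    obtain ⟨w', hw1, hw2, ew⟩ := red w
    rw [ez, ew]
    obtain ⟨⟨u, hu, hux, huy⟩, -⟩ := hL j z' hz1 hz2
    obtain ⟨-, ⟨v, hv, hvx, hvy⟩⟩ := hL j w' hw1 hw2
    have := hD j u hu v hv hux hvx
    linarith [hz2.1, hw2.2]
  refine ⟨D + 2 * L + 1, fun j z w => abs_le.2 ⟨?_, key j z w⟩⟩
  linarith [key j w z]

/-- The iterates of `g` stay at bounded distance from those of a translation. -/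
theorem exists_rotation_vector (h : IsChain Φ α C g η e 0 K) :
    ∃ (ρ : ℝ × ℝ) (D : ℝ), 0 < D ∧ ∀ (n : ℕ) (z : ℝ × ℝ), ‖(g ^ n) z - z - (n : ℝ) • ρ‖ ≤ D := by
  obtain ⟨D, hD⟩ := h.exists_displacement_bound
  have hD0 : 0 ≤ D := (abs_nonneg _).trans (hD 0 0 0)
  have hDn : ∀ (n : ℕ) (z w : ℝ × ℝ),
      |((g ^ n) z).2 - z.2 - (((g ^ n) w).2 - w.2)| ≤ D := fun n => by
    simpa using hD n
  obtain ⟨ρ, hρ⟩ := exists_linear_of_quasiadditive (s := fun n => ((g ^ n) 0).2) (D := D) (by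
    intro i j
    have := hDn i ((g ^ j) 0) 0
    rw [← Homeomorph.mul_apply, ← pow_add, Prod.snd_zero] at this
    convert this using 2
    ring)
  refine ⟨(η, ρ), 2 * D + C + 1, by linarith [h.bound.nonneg], fun n z => ?_⟩
  rw [Prod.norm_def]
  refine max_le ?_ ?_
  · have := (h.shift.zpow n).abs_le h.bound z
    simp only [zpow_natCast, Int.cast_natCast] at this
    simp only [Prod.fst_sub, Prod.smul_fst, smul_eq_mul, Real.norm_eq_abs]
    linarith
  · have h1 := abs_le.1 (hDn n z 0)
    have h2 := abs_le.1 (hρ n)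
    simp only [Prod.snd_sub, Prod.smul_snd, smul_eq_mul, Real.norm_eq_abs, Prod.snd_zero] at h1 h2 ⊢
    have := h.bound.nonneg
    rw [abs_le]
    constructor <;> linarith

end IsChain

end TorusRotationFactor

/-! ### Lifts, their lattice action, and homotopy to the identity. -/

namespace TorusRotationFactor

theorem proj_eq_iff {z w : ℝ × ℝ} :
    proj z = proj w ↔ ∃ m k : ℤ, z = w + ((m : ℝ), (k : ℝ)) := by
  have coe_iff : ∀ x y : ℝ, ((x : UnitAddCircle) = y) ↔ ∃ n : ℤ, x = y + n := by
    intro x y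
    rw [← sub_eq_zero, ← AddCircle.coe_sub, AddCircle.coe_eq_zero_iff]
    refine exists_congr fun n => ?_
    rw [zsmul_one]
    constructor <;> intro h <;> linarith
  rw [proj, proj, Prod.mk.injEq, coe_iff, coe_iff]
  constructor
  · rintro ⟨⟨m, hm⟩, ⟨k, hk⟩⟩
    exact ⟨m, k, Prod.ext hm hk⟩
  · rintro ⟨m, k, rfl⟩
    exact ⟨⟨m, rfl⟩, ⟨k, rfl⟩⟩

theorem isOpenQuotientMap_proj : IsOpenQuotientMap proj :=
  IsOpenQuotientMap.prodMap QuotientAddGroup.isOpenQuotientMap_mk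
    QuotientAddGroup.isOpenQuotientMap_mk

theorem proj_add (z w : ℝ × ℝ) : proj (z + w) = proj z + proj w := rfl

/-- Two continuous maps to the plane with the same projection differ by an integer vector. -/
theorem exists_eq_add_of_proj_eq {F G : ℝ × ℝ → ℝ × ℝ} (hF : Continuous F) (hG : Continuous G)
    (h : ∀ z, proj (F z) = proj (G z)) : ∃ v : ℤ × ℤ, ∀ z, F z = G z + ((v.1 : ℝ), (v.2 : ℝ)) := by
  choose m k hmk using fun z => proj_eq_iff.1 (h z)
  have hm : Continuous m := by
    rw [Int.isClosedEmbedding_coe_real.isEmbedding.continuous_iff]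
    have : ((↑) : ℤ → ℝ) ∘ m = fun z => (F z).1 - (G z).1 := by
      funext z; rw [hmk z]; simp
    rw [this]; fun_prop
  have hk : Continuous k := by
    rw [Int.isClosedEmbedding_coe_real.isEmbedding.continuous_iff]
    have : ((↑) : ℤ → ℝ) ∘ k = fun z => (F z).2 - (G z).2 := by
      funext z; rw [hmk z]; simp
    rw [this]; fun_prop
  refine ⟨(m 0, k 0), fun z => ?_⟩
  have e1 : m z = m 0 := PreconnectedSpace.constant inferInstance hm
  have e2 : k z = k 0 := PreconnectedSpace.constant inferInstance hk
  rw [hmk z, e1, e2]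

/-- Every homeomorphism of the torus has a lift. -/
theorem exists_isLift (f : T2 ≃ₜ T2) : ∃ G, IsLift G f := by
  have comp : ∀ u : C(ℝ × ℝ, UnitAddCircle), ∃ U : C(ℝ × ℝ, ℝ), ∀ z, (U z : UnitAddCircle) = u z := by
    intro u
    obtain ⟨e, he⟩ := QuotientAddGroup.mk_surjective (u 0)
    obtain ⟨U, ⟨-, hU⟩, -⟩ :=
      (AddCircle.isCoveringMap_coe (1 : ℝ)).existsUnique_continuousMap_lifts u 0 e he
    exact ⟨U, fun z => congrFun hU z⟩
  have hp := isOpenQuotientMap_proj.continuous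
  obtain ⟨U, hU⟩ := comp ⟨fun z => (f (proj z)).1, by fun_prop⟩
  obtain ⟨V, hV⟩ := comp ⟨fun z => (f (proj z)).2, by fun_prop⟩
  exact ⟨fun z => (U z, V z), by fun_prop, fun z => Prod.ext (hU z) (hV z)⟩

/-- A lift of a homeomorphism is a homeomorphism. -/
theorem IsLift.exists_homeomorph {f : T2 ≃ₜ T2} {F : ℝ × ℝ → ℝ × ℝ} (hF : IsLift F f) :
    ∃ Φ : (ℝ × ℝ) ≃ₜ (ℝ × ℝ), ∀ z, Φ z = F z := by
  obtain ⟨G, hG, hGf⟩ := exists_isLift f.symm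
  obtain ⟨v, hv⟩ := exists_eq_add_of_proj_eq (hF.1.comp hG) continuous_id fun z => by
    simp [hF.2, hGf]
  obtain ⟨w, hw⟩ := exists_eq_add_of_proj_eq (hG.comp hF.1) continuous_id fun z => by
    simp [hF.2, hGf]
  have hr : ∀ z, F (G (z - ((v.1 : ℝ), (v.2 : ℝ)))) = z := fun z => by
    have := hv (z - ((v.1 : ℝ), (v.2 : ℝ)))
    simpa using this
  have hinj : Function.Injective F := fun x y hxy => by
    have hx := hw x
    have hy := hw y
    simp only [Function.comp_apply, id] at hx hy
    rw [hxy, hy] at hx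
    exact (add_right_cancel hx).symm
  exact ⟨{ toFun := F
           invFun := fun z => G (z - ((v.1 : ℝ), (v.2 : ℝ)))
           left_inv := fun z => hinj (hr (F z))
           right_inv := hr
           continuous_toFun := hF.1
           continuous_invFun := hG.comp (by fun_prop) }, fun z => rfl⟩

theorem homeomorph_pow_apply {X : Type*} [TopologicalSpace X] (Φ : X ≃ₜ X) (n : ℕ) (z : X) :
    (Φ ^ n) z = Φ^[n] z := by
  induction n generalizing z with
  | zero => rfl
  | succ n ih => rw [pow_succ, Homeomorph.mul_apply, ih, Function.iterate_succ_apply]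

theorem proj_pow {f : T2 ≃ₜ T2} {Φ : (ℝ × ℝ) ≃ₜ (ℝ × ℝ)} (h : ∀ z, proj (Φ z) = f (proj z))
    (n : ℕ) (z : ℝ × ℝ) : proj ((Φ ^ n) z) = (f ^ n) (proj z) := by
  induction n generalizing z with
  | zero => rfl
  | succ n ih => rw [pow_succ, pow_succ, Homeomorph.mul_apply, Homeomorph.mul_apply, ih, h]

theorem int_eq_zero_of_bounded {x : ℤ} {B : ℝ} (h : ∀ m : ℤ, |(m : ℝ) * x| ≤ B) : x = 0 := by
  by_contra hx
  obtain ⟨m, hm⟩ := exists_int_mul_gt (η := (x : ℝ)) (by exact_mod_cast hx) B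
  exact absurd ((le_abs_self _).trans (h m)) (not_le.2 hm)

/-- The lattice action of a lift with bounded horizontal displacement. -/
theorem exists_actsOnLattice {f : T2 ≃ₜ T2} {Φ : (ℝ × ℝ) ≃ₜ (ℝ × ℝ)}
    (h : ∀ z, proj (Φ z) = f (proj z)) {B : ℝ} (hB : ∀ z, |(Φ z).1 - z.1| ≤ B) :
    ∃ c d : ℤ, d * d = 1 ∧ ActsOnLattice Φ c d := by
  have hconst : ∀ v : ℤ × ℤ, ∃ L : ℤ × ℤ, ∀ z,
      Φ (z + ((v.1 : ℝ), (v.2 : ℝ))) = Φ z + ((L.1 : ℝ), (L.2 : ℝ)) := fun v =>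
    exists_eq_add_of_proj_eq (Φ.continuous.comp (by fun_prop)) Φ.continuous fun z => by
      rw [h]
      refine (congrArg f ?_).trans (h z).symm
      exact proj_eq_iff.2 ⟨v.1, v.2, rfl⟩
  choose L hL using hconst
  have hadd : ∀ v w, L (v + w) = L v + L w := by
    intro v w
    have e1 := hL (v + w) 0
    have e2 := hL w (0 + ((v.1 : ℝ), (v.2 : ℝ)))
    rw [hL v 0, add_assoc 0] at e2
    have e3 : (((v + w).1 : ℝ), ((v + w).2 : ℝ))
        = ((v.1 : ℝ), (v.2 : ℝ)) + ((w.1 : ℝ), (w.2 : ℝ)) := by ext <;> simp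
    rw [e3, e2, add_assoc] at e1
    have e4 := add_left_cancel e1
    have f1 := congrArg Prod.fst e4
    have f2 := congrArg Prod.snd e4
    simp only [Prod.fst_add, Prod.snd_add] at f1 f2
    exact Prod.ext (by exact_mod_cast f1.symm) (by exact_mod_cast f2.symm)
  let LL : ℤ × ℤ →+ ℤ × ℤ := AddMonoidHom.mk' L hadd
  have hlin : ∀ m k : ℤ, L (m, k) = m • L (1, 0) + k • L (0, 1) := by
    intro m k
    have : ((m, k) : ℤ × ℤ) = m • (1, 0) + k • (0, 1) := by ext <;> simp
    have h1 : LL (m, k) = m • LL (1, 0) + k • LL (0, 1) := by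
      conv_lhs => rw [this]
      rw [map_add, map_zsmul, map_zsmul]
    exact h1
  have hbd : ∀ m k : ℤ, |((L (m, k)).1 : ℝ) - m| ≤ 2 * B := by
    intro m k
    have h1 := abs_le.1 (hB 0)
    have h2 := abs_le.1 (hB (0 + ((m : ℝ), (k : ℝ))))
    rw [hL (m, k) 0] at h2
    simp only [Prod.fst_add, Prod.fst_zero] at h1 h2
    rw [abs_le]
    constructor <;> linarith
  -- A linear function at bounded distance from `m` equals `m`; this determines the first row of the
  -- matrix.
  have h11 : (L (1, 0)).1 = 1 := by
    refine sub_eq_zero.1 (int_eq_zero_of_bounded (B := 2 * B) fun m => ?_)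
    have := hbd m 0
    rw [hlin] at this
    convert this using 2
    simp
    ring
  have h12 : (L (0, 1)).1 = 0 := by
    refine int_eq_zero_of_bounded (B := 2 * B) fun k => ?_
    have := hbd 0 k
    rw [hlin] at this
    convert this using 2
    simp
  have hact : ActsOnLattice Φ (L (1, 0)).2 (L (0, 1)).2 := by
    intro z m k
    have := hL (m, k) z
    rw [hlin] at this
    rw [this]
    congr 2
    · simp [h11, h12]
    · simp [mul_comm]
  refine ⟨_, _, ?_, hact⟩
  -- Injectivity of `f` makes the preimage of `Φ 0 + (0, 1)` an integer vector `(m, k)`. Its first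
  -- entry vanishes, so `d * k = 1`.
  have hy : proj (Φ.symm (Φ 0 + (0, ((1 : ℤ) : ℝ)))) = proj 0 := by
    apply f.injective
    rw [← h, ← h, Φ.apply_symm_apply]
    exact proj_eq_iff.2 ⟨0, 1, by simp⟩
  obtain ⟨m, k, hmk⟩ := proj_eq_iff.1 hy
  rw [Φ.symm_apply_eq, hact] at hmk
  have e := add_left_cancel hmk
  have e1 := congrArg Prod.fst e
  have e2 := congrArg Prod.snd e
  simp only at e1 e2
  have hm : m = 0 := by exact_mod_cast e1.symm
  have e3 : 1 = (L (1, 0)).2 * m + (L (0, 1)).2 * k := by exact_mod_cast e2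
  rw [hm, mul_zero, zero_add] at e3
  rcases Int.isUnit_iff.1 (IsUnit.of_mul_eq_one k e3.symm) with h | h <;> rw [h] <;> rfl

theorem hasHorizontalBound_of_nat {Φ : (ℝ × ℝ) ≃ₜ (ℝ × ℝ)} {a C : ℝ}
    (h : ∀ (n : ℕ) (z : ℝ × ℝ), |((Φ ^ n) z).1 - z.1 - n * a| ≤ C) :
    HasHorizontalBound Φ a C := by
  intro n z
  obtain ⟨k, rfl | rfl⟩ := n.eq_nat_or_neg
  · simpa using h k z
  · have h1 := abs_le.1 (h k ((Φ ^ (-(k : ℤ))) z))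
    have h2 : (Φ ^ k) ((Φ ^ (-(k : ℤ))) z) = z := by
      rw [← zpow_natCast, ← Homeomorph.mul_apply, ← zpow_add]
      simp
    rw [h2] at h1
    rw [abs_le]
    push_cast
    constructor <;> linarith

/-- A homeomorphism with a lift that commutes with integer translations is homotopic to the
identity. -/
theorem homotopic_id {φ : T2 ≃ₜ T2} {G : ℝ × ℝ → ℝ × ℝ} (hG : IsLift G φ)
    (hper : ∀ (z : ℝ × ℝ) (m k : ℤ), G (z + ((m : ℝ), (k : ℝ))) = G z + ((m : ℝ), (k : ℝ))) :
    ContinuousMap.Homotopic (φ : C(T2, T2)) (ContinuousMap.id T2) := by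
  let P : C(ℝ × ℝ, T2) := ⟨proj, isOpenQuotientMap_proj.continuous⟩
  have hP : IsQuotientMap P := isOpenQuotientMap_proj.isQuotientMap
  have hGc := hG.1
  -- The displacement is periodic, hence descends to the torus; scaling it to zero is the homotopy.
  let D : C(ℝ × ℝ, ℝ × ℝ) := ⟨fun z => G z - z, by fun_prop⟩
  have hD : Function.FactorsThrough D P := by
    intro z w hzw
    obtain ⟨m, k, rfl⟩ := proj_eq_iff.1 hzw
    simp only [D, ContinuousMap.coe_mk, hper]
    abel
  let E : C(T2, ℝ × ℝ) := hP.lift D hD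
  have hE : ∀ z, E (proj z) = G z - z := fun z =>
    DFunLike.congr_fun (hP.lift_comp D hD) z
  have hpc := isOpenQuotientMap_proj.continuous
  refine ⟨{ toFun := fun q => q.2 + proj ((1 - (q.1 : ℝ)) • E q.2)
            continuous_toFun := by fun_prop
            map_zero_left := fun q => ?_
            map_one_left := fun q => ?_ }⟩
  · obtain ⟨z, rfl⟩ := isOpenQuotientMap_proj.surjective q
    simp only [Icc.coe_zero, sub_zero, one_smul, hE]
    rw [← proj_add, add_sub_cancel, hG.2]
    rfl
  · simp only [Icc.coe_one, sub_self, zero_smul]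
    exact add_zero q

end TorusRotationFactor

/-! ### Speed, descent of the level, and the dichotomy. -/

namespace TorusRotationFactor

variable {Φ : (ℝ × ℝ) ≃ₜ (ℝ × ℝ)} {α C : ℝ}

theorem ActsOnLattice.sq {c d : ℤ} (h : ActsOnLattice Φ c d) (hd : d * d = 1) :
    ActsOnLattice (Φ * Φ) (c + d * c) 1 := hd ▸ h.mul h

/-- There are arbitrarily long orbit segments with at most linear vertical displacement. -/
theorem exists_linear_displacement {Ψ : (ℝ × ℝ) ≃ₜ (ℝ × ℝ)} {c : ℤ} (h : ActsOnLattice Ψ c 1) :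
    ∃ B : ℝ, ∀ k : ℕ, ∃ z : ℝ × ℝ, |((Ψ ^ k) z).2 - z.2| ≤ k * B := by
  by_cases hc : c = 0
  · subst hc
    obtain ⟨B, hB⟩ := ((isCompact_Icc (a := (0 : ℝ)) (b := 1)).prod
      (isCompact_Icc (a := (0 : ℝ)) (b := 1))).image
      (f := fun z : ℝ × ℝ => |(Ψ z).2 - z.2|)
      ((((continuous_snd.comp Ψ.continuous).sub continuous_snd)).abs) |>.bddAbove
    have hall : ∀ z, |(Ψ z).2 - z.2| ≤ B := by
      intro z
      have hz : z = (Int.fract z.1, Int.fract z.2) + ((⌊z.1⌋ : ℝ), (⌊z.2⌋ : ℝ)) := by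
        ext <;> simp
      have e := congrArg Prod.snd (h (Int.fract z.1, Int.fract z.2) ⌊z.1⌋ ⌊z.2⌋)
      rw [← hz] at e
      have hm := hB ⟨(Int.fract z.1, Int.fract z.2),
        ⟨⟨Int.fract_nonneg _, (Int.fract_lt_one _).le⟩,
          ⟨Int.fract_nonneg _, (Int.fract_lt_one _).le⟩⟩, rfl⟩
      have e2 : (Ψ z).2 - z.2 = (Ψ (Int.fract z.1, Int.fract z.2)).2 - Int.fract z.2 := by
        rw [e, Prod.snd_add]
        push_cast
        linarith [Int.fract_add_floor z.2]
      rw [e2]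
      exact hm
    refine ⟨B, fun k => ⟨0, ?_⟩⟩
    induction k with
    | zero => simp
    | succ k ih =>
      rw [pow_succ', Homeomorph.mul_apply]
      have h1 := abs_le.1 (hall ((Ψ ^ k) 0))
      have h2 := abs_le.1 ih
      rw [abs_le]
      push_cast
      constructor <;> linarith
  -- Moving the starting point horizontally by an integer `m` changes the displacement after `k`
  -- steps by `k * c * m`, so it can be reduced modulo `k * c`.
  · refine ⟨|(c : ℝ)|, fun k => ?_⟩
    rcases Nat.eq_zero_or_pos k with rfl | hk
    · exact ⟨0, by simp⟩
    set y := ((Ψ ^ k) 0).2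
    have hkc : (k : ℝ) * c ≠ 0 := by
      have : (k : ℝ) ≠ 0 := by exact_mod_cast hk.ne'
      exact mul_ne_zero this (by exact_mod_cast hc)
    refine ⟨0 + (((-⌊y / (k * c)⌋ : ℤ) : ℝ), ((0 : ℤ) : ℝ)), ?_⟩
    have e := h.zpow_one k 0 (-⌊y / (k * c)⌋) 0
    rw [zpow_natCast] at e
    rw [e]
    have e2 : y - k * c * ⌊y / (k * c)⌋ = k * c * Int.fract (y / (k * c)) := by
      rw [Int.fract]
      field_simp
    simp only [Prod.snd_add, Prod.snd_zero]
    push_cast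
    rw [show ((Ψ ^ k) 0).2 + (k * c * -⌊y / (k * c)⌋ + 0) - (0 + 0)
      = y - (k : ℝ) * c * ⌊y / (k * c)⌋ by ring, e2, abs_mul, abs_mul, Nat.abs_cast,
      abs_of_nonneg (Int.fract_nonneg (y / (k * c)))]
    have := (Int.fract_lt_one (y / (k * c))).le
    exact mul_le_of_le_one_right (by positivity) this

/-- The speed of the horizontal motion is the first coordinate of every rotation vector. -/
theorem speed_eq {F : ℝ × ℝ → ℝ × ℝ} {a : ℝ} (hF : ∀ z, Φ z = F z)
    (hrot : rotationSet F ⊆ {α} ×ˢ univ) {c d : ℤ} (hΦ : ActsOnLattice Φ c d) (hd : d * d = 1)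
    (hb : HasHorizontalBound Φ a C) : a = α := by
  obtain ⟨B, hB⟩ := exists_linear_displacement (hΦ.sq hd)
  choose z hz using hB
  have hFn : ∀ n w, F^[n] w = (Φ ^ n) w := fun n w => by
    rw [homeomorph_pow_apply, show F = Φ from (funext hF).symm]
  -- The inclusion `hrot` says something about `a` only once a rotation vector is exhibited.
  -- Vertical control along even iterates keeps `x` in a compact set, and its limit points have
  -- first coordinate `a`.
  set x : ℕ → ℝ × ℝ := fun k =>
    ((2 * (k + 1) : ℕ) : ℝ)⁻¹ • (F^[2 * (k + 1)] (z (k + 1)) - z (k + 1))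
  have hx1 : ∀ k, |(x k).1 - a| ≤ C / ((k : ℝ) + 1) := by
    intro k
    have hk : (0 : ℝ) < (k : ℝ) + 1 := by positivity
    have h1 := hb ((2 * (k + 1) : ℕ) : ℤ) (z (k + 1))
    rw [zpow_natCast, ← hFn] at h1
    have e : (x k).1 - a = ((2 * (k + 1) : ℕ) : ℝ)⁻¹ *
        ((F^[2 * (k + 1)] (z (k + 1))).1 - (z (k + 1)).1 - ((2 * (k + 1) : ℕ) : ℤ) * a) := by
      simp only [x, Prod.smul_fst, Prod.fst_sub, smul_eq_mul]
      push_cast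
      field_simp
    rw [e, abs_mul, abs_of_nonneg (by positivity), inv_mul_eq_div]
    have hC := hb.nonneg
    calc _ ≤ C / ((2 * (k + 1) : ℕ) : ℝ) := by gcongr
      _ ≤ C / ((k : ℝ) + 1) := by
        gcongr
        push_cast
        linarith
  have hx2 : ∀ k, |(x k).2| ≤ |B| := by
    intro k
    have h1 := hz (k + 1)
    rw [← pow_two, ← pow_mul, ← hFn] at h1
    simp only [x, Prod.smul_snd, Prod.snd_sub, smul_eq_mul]
    have hk : (0 : ℝ) < (k : ℝ) + 1 := by positivity
    rw [abs_mul, abs_of_nonneg (by positivity), inv_mul_le_iff₀ (by positivity)]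
    refine h1.trans ?_
    push_cast
    nlinarith [le_abs_self B, abs_nonneg B]
  have hmem : ∀ k, x k ∈ Icc (a - C) (a + C) ×ˢ Icc (-|B|) |B| := by
    intro k
    have h1 : C / ((k : ℝ) + 1) ≤ C :=
      div_le_self hb.nonneg (by linarith [Nat.cast_nonneg (α := ℝ) k])
    have h2 := abs_le.1 ((hx1 k).trans h1)
    exact ⟨⟨by linarith, by linarith⟩, abs_le.1 (hx2 k)⟩
  obtain ⟨w, -, φ, hφ, hw⟩ := (isCompact_Icc.prod isCompact_Icc).tendsto_subseq hmem
  have hwrot : w ∈ rotationSet F := by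
    refine mem_iInter.2 fun n => mem_closure_of_tendsto hw ?_
    filter_upwards [Filter.eventually_ge_atTop n] with k hk
    refine mem_iUnion₂.2 ⟨2 * (φ k + 1), ?_, ⟨z (φ k + 1), rfl⟩⟩
    have := hφ.id_le k
    simp only [id] at this
    omega
  have hwα : w.1 = α := (hrot hwrot).1
  have hlim : Filter.Tendsto (fun k => (x k).1) Filter.atTop (𝓝 a) := by
    rw [tendsto_iff_dist_tendsto_zero]
    refine squeeze_zero (fun _ => dist_nonneg) (fun k => hx1 k) ?_
    have h1 : Filter.Tendsto (fun n : ℕ => C / (n : ℝ)) Filter.atTop (𝓝 0) :=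
      tendsto_const_div_atTop_nhds_zero_nat C
    have h2 := (Filter.tendsto_add_atTop_iff_nat 1).2 h1
    exact h2.congr fun k => by push_cast; rfl
  have := tendsto_nhds_unique (hlim.comp hφ.tendsto_atTop) ((continuous_fst.tendsto w).comp hw)
  rw [this, hwα]

/-- A continuous level function descends to a semiconjugacy. -/
theorem isSemiconjugateToRotation_of_continuous_level {f : T2 ≃ₜ T2}
    (hf : ∀ z, proj (Φ z) = f (proj z)) (hb : HasHorizontalBound Φ α C) {c d : ℤ}
    (hΦ : ActsOnLattice Φ c d) (hd : d * d = 1) (hc : Continuous (level Φ α C)) :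
    IsSemiconjugateToRotation f α := by
  let P : C(ℝ × ℝ, T2) := ⟨proj, isOpenQuotientMap_proj.continuous⟩
  have hP : IsQuotientMap P := isOpenQuotientMap_proj.isQuotientMap
  have htr : ∀ (z : ℝ × ℝ) (m k : ℤ),
      level Φ α C (z + ((m : ℝ), (k : ℝ))) = level Φ α C z + m := fun z m k =>
    (isShift_translation hΦ hd m k).level_eq hb z
  let H : C(ℝ × ℝ, T1) := ⟨fun z => ((level Φ α C z : ℝ) : T1),
    (AddCircle.continuous_mk' 1).comp hc⟩
  have hfac : Function.FactorsThrough H P := by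
    intro z w hzw
    obtain ⟨m, k, rfl⟩ := proj_eq_iff.1 hzw
    change ((level Φ α C (w + ((m : ℝ), (k : ℝ))) : ℝ) : T1) = ((level Φ α C w : ℝ) : T1)
    rw [htr, AddCircle.coe_add, (AddCircle.coe_eq_zero_iff (1 : ℝ) (x := (m : ℝ))).2 ⟨m, by simp⟩, add_zero]
  let h : C(T2, T1) := hP.lift H hfac
  have hh : ∀ z, h (proj z) = ((level Φ α C z : ℝ) : T1) := fun z =>
    DFunLike.congr_fun (hP.lift_comp H hfac) z
  refine ⟨h, h.continuous, fun θ => ?_, fun q => ?_⟩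
  · obtain ⟨x, rfl⟩ := QuotientAddGroup.mk_surjective θ
    obtain ⟨z, hz⟩ : x ∈ range (level Φ α C) := by
      obtain ⟨n, hn⟩ := exists_nat_gt |x - level Φ α C 0|
      have hn' := abs_lt.1 hn
      refine mem_range_of_exists_le_of_exists_ge hc
        ⟨0 + (((-n : ℤ) : ℝ), ((0 : ℤ) : ℝ)), ?_⟩ ⟨0 + (((n : ℤ) : ℝ), ((0 : ℤ) : ℝ)), ?_⟩
      · rw [htr]; push_cast; linarith
      · rw [htr]; push_cast; linarith
    exact ⟨proj z, by rw [hh, hz]⟩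
  · obtain ⟨z, rfl⟩ := isOpenQuotientMap_proj.surjective q
    simp only
    rw [← hf, hh, hh, isShift_self.level_eq hb, AddCircle.coe_add]

/-- If some strip contains no vertically essential curve, then neither does any sufficiently
thin strip. -/
theorem no_essential_curve_of_thin (hb : HasHorizontalBound Φ α C) {c d : ℤ}
    (hΦ : ActsOnLattice Φ c d) (hd : d * d = 1) (hα : Irrational α) {r₀ s₀ e : ℝ} (he : 0 < e)
    (hrs : s₀ = r₀ + 16 * e)
    (h : ∀ (p : ℝ × ℝ) (l : ℤ), l ≠ 0 → ¬ JoinedIn (strip Φ α C r₀ s₀) p (p + (0, (l : ℝ))))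
    (r : ℝ) (p : ℝ × ℝ) (l : ℤ) (hl : l ≠ 0) :
    ¬ JoinedIn (strip Φ α C (r - 4 * e) (r + 4 * e)) p (p + (0, (l : ℝ))) := by
  intro hj
  -- These are the shifts that place a strip of width `8 * e` inside the given one of width `16 *
  -- e`.
  obtain ⟨n, m, h1, h2⟩ := exists_int_mul_add_mem_Ioo hα (x := r₀ + 4 * e - r)
    (y := r₀ + 12 * e - r) (by linarith)
  obtain ⟨Ψ, c', d', hd', hΨl, hΨs⟩ := exists_shift (α := α) hΦ hd n m
  have hmap : JoinedIn (strip Φ α C r₀ s₀) (Ψ p) (Ψ (p + (0, (l : ℝ)))) := by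
    refine (hj.map (f := Ψ) Ψ.continuous).mono ?_
    rintro _ ⟨z, hz, rfl⟩
    exact strip_mono hb (by linarith) (by linarith) ((hΨs.mem_strip_iff hb _ _ z).1 hz)
  have e1 : Ψ (p + (0, (l : ℝ))) = Ψ p + (0, ((d' * l : ℤ) : ℝ)) := by
    have := hΨl p 0 l
    simpa using this
  rw [e1] at hmap
  refine h _ _ (mul_ne_zero ?_ hl) hmap
  rintro rfl
  simp at hd'

/-- If some strip contains no vertically essential curve, a nonwandering homeomorphism has an
iterate that is a pseudo-rotation with uniformly bounded deviations. -/
theorem exists_isPseudoRotationBdd {f : T2 ≃ₜ T2} (hnw : IsNonwandering f)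
    (hf : ∀ z, proj (Φ z) = f (proj z)) (hb : HasHorizontalBound Φ α C) {c d : ℤ}
    (hΦ : ActsOnLattice Φ c d) (hd : d * d = 1) (hα : Irrational α) {r₀ s₀ : ℝ} (hrs : r₀ < s₀)
    (h : ∀ (p : ℝ × ℝ) (l : ℤ), l ≠ 0 → ¬ JoinedIn (strip Φ α C r₀ s₀) p (p + (0, (l : ℝ)))) :
    ∃ k : ℕ, 1 ≤ k ∧ IsPseudoRotationBdd (f ^ k) := by
  set e := (s₀ - r₀) / 16
  have he : 0 < e := by simp only [e]; linarith
  obtain ⟨x, hx⟩ := strip_nonempty hb hΦ hd hα (show -(e / 4) < e / 4 by linarith)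
  obtain ⟨ε, hε, hball⟩ := Metric.isOpen_iff.1 (isOpen_strip _ _) x hx
  obtain ⟨n, hn, q, ⟨_, ⟨z, hz, rfl⟩, hzq⟩, ⟨w, hw, rfl⟩⟩ := hnw (proj '' Metric.ball x ε)
    (isOpenQuotientMap_proj.isOpenMap _ Metric.isOpen_ball)
    ⟨proj x, mem_image_of_mem _ (Metric.mem_ball_self hε)⟩
  rw [← proj_pow hf] at hzq
  obtain ⟨m, k, hmk⟩ := proj_eq_iff.1 hzq
  obtain ⟨c₁, d₁, hd₁, hl₁⟩ := hΦ.pow hd n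
  set T : (ℝ × ℝ) ≃ₜ (ℝ × ℝ) := Homeomorph.addRight (((-m : ℤ) : ℝ), ((-k : ℤ) : ℝ))
  set g₀ : (ℝ × ℝ) ≃ₜ (ℝ × ℝ) := T * Φ ^ n
  have hg₀ : ∀ u, g₀ u = (Φ ^ n) u + (((-m : ℤ) : ℝ), ((-k : ℤ) : ℝ)) := fun u => rfl
  have hg₀z : g₀ z = w := by
    rw [hg₀, hmk]
    ext <;> simp
  have hlat₀ : ActsOnLattice g₀ c₁ d₁ := by
    intro u m' k'
    rw [hg₀, hg₀, hl₁]
    abel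
  set η₀ : ℝ := ((-m : ℤ) : ℝ) + n * α
  have hsh₀ : IsShift Φ α g₀ η₀ := by
    have h1 := (isShift_self (Φ := Φ) (α := α)).zpow n
    rw [zpow_natCast, Int.cast_natCast] at h1
    exact (isShift_translation hΦ hd (-m) (-k)).mul h1
  -- Irrationality of `α` and `n ≥ 1` enter here: the return cannot preserve the level.
  have hη₀ : η₀ ≠ 0 := by
    have hirr : Irrational (((-m : ℤ) : ℝ) + (n : ℝ) * α) :=
      (hα.natCast_mul (by omega)).intCast_add _
    exact hirr.ne_zero
  -- The point `w` lies both in the strip of half-width `e / 4` and in its shift by `η₀`, so the two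
  -- overlap.
  have hbd : |η₀| < e / 2 := by
    have s1 := hball hw
    have s2 := (hsh₀.mem_strip_iff hb _ _ z).1 (hball hz)
    rw [hg₀z] at s2
    have a1 := lt_of_mem_left_right s1.1 s2.2
    have a2 := lt_of_mem_left_right s2.1 s1.2
    rw [abs_lt]
    constructor <;> linarith
  have hbd' := abs_lt.1 hbd
  set S := segment ℝ z w
  have hS : S ⊆ strip Φ α C (-(e / 4)) (e / 4) :=
    ((convex_ball x ε).segment_subset hz hw).trans hball
  have hSc : IsCompact S := by
    simp only [S]
    rw [segment_eq_image_lineMap]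
    exact isCompact_Icc.image AffineMap.lineMap_continuous
  have hSp : IsPathConnected S := (convex_segment z w).isPathConnected ⟨z, left_mem_segment ℝ z w⟩
  -- Squaring makes the vertical lattice action `+1` and keeps the shift below `e`. The segment `S`
  -- and its image share `w = g₀ z`, and `g z = g₀ w` lies in both `g₀ '' S` and `g '' S`, so the
  -- union is a chain.
  set g := g₀ * g₀
  have hchain : IsChain Φ α C g (η₀ + η₀) e (c₁ + d₁ * c₁) (S ∪ g₀ '' S) :=
    { bound := hb
      translation := isShift_translation hΦ hd
      lattice := hlat₀.sq hd₁
      shift := hsh₀.mul hsh₀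
      shift_ne := by
        intro h0
        exact hη₀ (by linarith)
      shift_le := by
        rw [abs_le]
        constructor <;> linarith
      compact := hSc.union (hSc.image g₀.continuous)
      pathConnected := hSp.union (hSp.image g₀.continuous)
        ⟨w, right_mem_segment ℝ z w, z, left_mem_segment ℝ z w, hg₀z⟩
      meets := ⟨g z, Or.inr ⟨w, right_mem_segment ℝ z w,
          (congrArg g₀ hg₀z).symm⟩, z, Or.inl (left_mem_segment ℝ z w), rfl⟩
      subset := by
        rintro u (hu | ⟨u, hu, rfl⟩)
        · exact strip_mono hb (by linarith) (by linarith) (hS hu)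
        · exact strip_mono hb (by linarith) (by linarith)
            ((hsh₀.mem_strip_iff hb _ _ u).1 (hS hu))
      no_loop := no_essential_curve_of_thin hb hΦ hd hα he (by simp only [e]; ring) h }
  have hproj₀ : ∀ u, proj (g₀ u) = (f ^ n) (proj u) := fun u => by
    rw [← proj_pow hf, hg₀]
    exact proj_eq_iff.2 ⟨-m, -k, rfl⟩
  have hlift : IsLift g (f ^ (2 * n)) := by
    refine ⟨g.continuous, fun u => ?_⟩
    rw [Homeomorph.mul_apply, hproj₀, hproj₀, two_mul, pow_add, Homeomorph.mul_apply]
  have hc0 := hchain.twist_eq_zero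
  rw [hc0] at hchain
  obtain ⟨ρ, D, hD, hρ⟩ := hchain.exists_rotation_vector
  refine ⟨2 * n, by omega, homotopic_id hlift fun u m' k' => ?_, g, ρ, D, hlift, hD, fun j u => ?_⟩
  · have := hchain.lattice u m' k'
    simpa using this
  · rw [← homeomorph_pow_apply]
    exact hρ j u

/-- A nonwandering torus homeomorphism with bounded horizontal deviations and irrational
horizontal speed is semiconjugate to a rotation, unless an iterate is a pseudo-rotation with
uniformly bounded deviations. -/
theorem isSemiconjugateToRotation {f : T2 ≃ₜ T2} {F : ℝ × ℝ → ℝ × ℝ} (hF : IsLift F f)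
    (hnw : IsNonwandering f) (hα : Irrational α) (hrot : rotationSet F ⊆ {α} ×ˢ univ)
    (hdev : HasBoundedDeviations F (1, 0))
    (hpr : ∀ k : ℕ, 1 ≤ k → ¬ IsPseudoRotationBdd (f ^ k)) :
    IsSemiconjugateToRotation f α := by
  obtain ⟨Φ, hΦF⟩ := hF.exists_homeomorph
  obtain ⟨a, -, C, -, hC⟩ := hdev
  have hf : ∀ z, proj (Φ z) = f (proj z) := fun z => by rw [hΦF, hF.2]
  have hb : HasHorizontalBound Φ a C := hasHorizontalBound_of_nat fun n z => by
    have := hC n z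
    rw [show F = Φ from (funext hΦF).symm, ← homeomorph_pow_apply] at this
    simpa [dot] using this
  have hdisp : ∀ z, |(Φ z).1 - z.1| ≤ C + |a| := fun z => by
    have h1 := hb 1 z
    rw [zpow_one, Int.cast_one, one_mul] at h1
    have h2 := abs_add_le ((Φ z).1 - z.1 - a) a
    rw [sub_add_cancel] at h2
    linarith
  obtain ⟨c, d, hd, hact⟩ := exists_actsOnLattice hf hdisp
  obtain rfl : a = α := speed_eq hΦF hrot hact hd hb
  by_cases hess : ∀ r s, r < s → ∃ (p : ℝ × ℝ) (l : ℤ), l ≠ 0 ∧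
      JoinedIn (strip Φ a C r s) p (p + (0, (l : ℝ)))
  · exact isSemiconjugateToRotation_of_continuous_level hf hb hact hd
      (continuous_level hb hess hact hd)
  · push Not at hess
    obtain ⟨r, s, hrs, hno⟩ := hess
    obtain ⟨k, hk, hps⟩ := exists_isPseudoRotationBdd hnw hf hb hact hd hα hrs hno
    exact absurd hps (hpr k hk)

end TorusRotationFactor

theorem theorem2
    (f : TorusRotationFactor.T2 ≃ₜ TorusRotationFactor.T2)
    (F : ℝ × ℝ → ℝ × ℝ) (hF : TorusRotationFactor.IsLift F f)
    (hnw : TorusRotationFactor.IsNonwandering f)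
    (hna : ¬ TorusRotationFactor.IsEventuallyAnnular f)
    (α : ℝ) (hα : Irrational α)
    (hrot : TorusRotationFactor.rotationSet F ⊆ {α} ×ˢ Set.univ)
    (hdev : TorusRotationFactor.HasBoundedDeviations F (1, 0))
    (hpr : ∀ k : ℕ, 1 ≤ k → ¬ TorusRotationFactor.IsPseudoRotationBdd (f ^ k)) :
    TorusRotationFactor.IsSemiconjugateToRotation f α :=
  TorusRotationFactor.isSemiconjugateToRotation hF hnw hα hrot hdev hpr
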